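/- Let $N\ge 1$ be an integer, let $\omega\in\mathbb{C}$ be a primitive $N$-th root of unity and let $\mathbb{Z}_N=\mathbb{Z}/N\mathbb{Z}$. A $\mathbb{Z}_N$-$C^*$-algebra is a unital $C^*$-algebra $X$ with a coaction $\rho\colon X\to X\otimes C(\mathbb{Z}_N)=C(\mathbb{Z}_N,X)$, $x\mapsto(t\mapsto\rho_t(x))$, that is, a unital $*$-homomorphism with $(\rho\otimes\mathrm{id})\rho=(\mathrm{id}\otimes\Delta_{\mathbb{Z}_N})\rho$ for which $\rho(X)(1\otimes C(\mathbb{Z}_N))$ spans a dense subspace of $X\otimes C(\mathbb{Z}_N)$; an equivariant morphism is a unital $*$-homomorphism $\phi$ with $\rho_t\phi=\phi\rho_t$ for all $t$. The element $x$ has degree $d$ if $\rho_t(x)=\omega^{td}x$ for all $t$. For $\mathbb{Z}_N$-$C^*$-algebras $X$ and $Y$, represented faithfully and equivariantly on Hilbert spaces $\mathcal{L}^X$ and $\mathcal{L}^Y$ with unitary representations of $\mathbb{Z}_N$, the braided tensor product $X\boxtimes_R Y$ is the $C^*$-subalgebra of $\mathbb{B}(\mathcal{L}^X\otimes\mathcal{L}^Y)$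 generated by the products $j_1(x)j_2(y)$, $x\in X$, $y\in Y$, where $j_1(x)=x\otimes 1$, $j_2(y)=c^{-1}(y\otimes 1)c$ and $c\colon\mathcal{L}^X\otimes\mathcal{L}^Y\to\mathcal{L}^Y\otimes\mathcal{L}^X$ is the unitary with $c(\xi\otimes\eta)=\omega^{mn}\,\eta\otimes\xi$ for $\xi,\eta$ of degrees $m,n$. It does not depend on the choice of the representations, and $j_1(x)j_2(y)=\omega^{\deg x\deg y}j_2(y)j_1(x)$ for homogeneous $x,y$. For equivariant morphisms $\phi\colon X\to X'$ and $\psi\colon Y\to Y'$, the morphism $\phi\boxtimes_R\psi\colon X\boxtimes_R Y\to X'\boxtimes_R Y'$ maps $j_1(x)j_2(y)$ to $j_1(\phi(x))j_2(\psi(y))$. Let $C(S_N^+(R))$ be the universal unital $C^*$-algebra with generators $q_{ij}$, $i,j\in\mathbb{Z}_N$, and the following relations, for all $i,j,k\in\mathbb{Z}_N$: (1) $q_{0i}=q_{i0}=\delta_{i0}$; (2) $q_{ij}^*=\omega^{-i(i-j)}q_{-i,-j}$; (3) $q_{k,i+j}=\sum_{l\in\mathbb{Z}_N}\omega^{-l(i-k+l)}q_{k-l,i}\,q_{lj}$;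 (4) $q_{i+j,k}=\sum_{l\in\mathbb{Z}_N}\omega^{-i(l-j)}q_{jl}\,q_{i,k-l}$. Let $C(U_N^+(R))$ be the universal unital $C^*$-algebra with generators $u_{ij}$, $i,j\in\mathbb{Z}_N$, subject to the relations that the matrices $u=(u_{ij})$ and $\overline{u}_R=(\omega^{-i(j-i)}u_{ij}^*)$ are unitary. Both are $\mathbb{Z}_N$-$C^*$-algebras through $\rho_t(q_{ij})=\omega^{t(j-i)}q_{ij}$ and $\rho_t(u_{ij})=\omega^{t(j-i)}u_{ij}$, and they carry the comultiplications $\Delta_S\colon C(S_N^+(R))\to C(S_N^+(R))\boxtimes_R C(S_N^+(R))$ and $\Delta_U\colon C(U_N^+(R))\to C(U_N^+(R))\boxtimes_R C(U_N^+(R))$ with $\Delta_S(q_{ij})=\sum_k j_1(q_{ik})j_2(q_{kj})$ and $\Delta_U(u_{ij})=\sum_k j_1(u_{ik})j_2(u_{kj})$. Theorem. The matrices $q=(q_{ij})$ and $\overline{q}_R=(\omega^{-i(j-i)}q_{ij}^*)$ over $C(S_N^+(R))$ are unitary. There is a unique $\mathbb{Z}_N$-equivariant Hopf $*$-homomorphism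 $\phi\colon C(U_N^+(R))\to C(S_N^+(R))$, that is, a unique equivariant morphism $\phi$ with $\Delta_S\circ\phi=(\phi\boxtimes_R\phi)\circ\Delta_U$, such that $\phi(u_{ij})=q_{ij}$ for all $i,j\in\mathbb{Z}_N$. Moreover, $\phi$ is surjective, so that $S_N^+(R)$ is a quantum subgroup, in the braided sense, of $U_N^+(R)$. -/

import Mathlib

noncomputable section

namespace Anyonic

open scoped TensorProduct ComplexConjugate
open UniformSpace

/-! ### The free unital `*`-algebra on a set of generators -/

/-- The free unital complex algebra on `G` and a disjoint copy of `G`; the generator `Sum.inr g`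
plays the role of the adjoint of the generator `Sum.inl g`. -/
def FreeStarAlg (G : Type*) : Type _ := FreeAlgebra ℂ (G ⊕ G)

namespace FreeStarAlg

variable {G : Type*}

instance : Ring (FreeStarAlg G) := inferInstanceAs (Ring (FreeAlgebra ℂ (G ⊕ G)))
instance : Algebra ℂ (FreeStarAlg G) := inferInstanceAs (Algebra ℂ (FreeAlgebra ℂ (G ⊕ G)))

/-- The generators and their formal adjoints. -/
def letter (z : G ⊕ G) : FreeStarAlg G := FreeAlgebra.ι ℂ z

/-- The generators. -/
def gen (g : G) : FreeStarAlg G := letter (Sum.inl g)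

theorem induction {P : FreeStarAlg G → Prop} (h₀ : ∀ r : ℂ, P (algebraMap ℂ _ r))
    (h₁ : ∀ z, P (letter z)) (hm : ∀ a b, P a → P b → P (a * b))
    (ha : ∀ a b, P a → P b → P (a + b)) (a : FreeStarAlg G) : P a :=
  FreeAlgebra.induction ℂ (G ⊕ G) (motive := P) h₀ h₁ hm ha a

/-- The opposite of the free algebra, with complex scalars acting through complex conjugation. -/
def ConjOp (G : Type*) : Type _ := (FreeStarAlg G)ᵐᵒᵖ

instance : Ring (ConjOp G) := inferInstanceAs (Ring (FreeStarAlg G)ᵐᵒᵖ)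
instance : Algebra ℂ (ConjOp G) :=
  RingHom.toAlgebra' ((algebraMap ℂ (FreeStarAlg G)ᵐᵒᵖ).comp (starRingEnd ℂ))
    fun c x => Algebra.commutes (A := (FreeStarAlg G)ᵐᵒᵖ) (conj c) x

/-- The conjugate linear antimultiplicative map that exchanges each generator with its adjoint. -/
def starAux : FreeStarAlg G →ₐ[ℂ] ConjOp G :=
  FreeAlgebra.lift ℂ fun z => (MulOpposite.op (letter z.swap) : (FreeStarAlg G)ᵐᵒᵖ)

instance : Star (FreeStarAlg G) :=
  ⟨fun a => MulOpposite.unop (show (FreeStarAlg G)ᵐᵒᵖ from starAux a)⟩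

theorem star_letter (z : G ⊕ G) : star (letter z) = letter z.swap :=
  congrArg MulOpposite.unop
    (FreeAlgebra.lift_ι_apply (R := ℂ) (A := ConjOp G)
      (fun z : G ⊕ G => (MulOpposite.op (letter z.swap : FreeStarAlg G) : (FreeStarAlg G)ᵐᵒᵖ)) z)

theorem star_algebraMap' (c : ℂ) :
    star (algebraMap ℂ (FreeStarAlg G) c) = algebraMap ℂ (FreeStarAlg G) (conj c) :=
  congrArg MulOpposite.unop ((starAux (G := G)).commutes c)

instance : StarRing (FreeStarAlg G) where
  star_mul a b := congrArg MulOpposite.unop (map_mul (starAux (G := G)) a b)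
  star_add a b := congrArg MulOpposite.unop (map_add (starAux (G := G)) a b)
  star_involutive a := by
    have hm : ∀ a b : FreeStarAlg G, star (a * b) = star b * star a := fun a b =>
      congrArg MulOpposite.unop (map_mul (starAux (G := G)) a b)
    have ha : ∀ a b : FreeStarAlg G, star (a + b) = star a + star b := fun a b =>
      congrArg MulOpposite.unop (map_add (starAux (G := G)) a b)
    induction a using induction with
    | h₀ r => rw [star_algebraMap', star_algebraMap', Complex.conj_conj]
    | h₁ z => rw [star_letter, star_letter, Sum.swap_swap]
    | hm a b h₁ h₂ => rw [hm, hm, h₁, h₂]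
    | ha a b h₁ h₂ => rw [ha, ha, h₁, h₂]

instance : StarModule ℂ (FreeStarAlg G) where
  star_smul c a := by
    rw [Algebra.smul_def, star_mul, star_algebraMap', Algebra.smul_def]
    exact (Algebra.commutes _ _).symm

section lift

variable {B : Type*} [Ring B] [StarRing B] [Algebra ℂ B]

/-- The algebra homomorphism with given values on the generators and on their adjoints. -/
def liftAlg (f : G → B) : FreeStarAlg G →ₐ[ℂ] B :=
  FreeAlgebra.lift ℂ (Sum.elim f fun g => star (f g))

theorem liftAlg_letter (f : G → B) (z : G ⊕ G) :
    liftAlg f (letter z) = Sum.elim f (fun g => star (f g)) z :=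
  FreeAlgebra.lift_ι_apply (R := ℂ) (Sum.elim f fun g => star (f g)) z

/-- The universal property of the free `*`-algebra. -/
def lift [StarModule ℂ B] (f : G → B) : FreeStarAlg G →⋆ₐ[ℂ] B where
  __ := liftAlg f
  map_star' a := by
    change liftAlg f (star a) = star (liftAlg f a)
    induction a using induction with
    | h₀ r =>
      rw [star_algebraMap', AlgHom.commutes, AlgHom.commutes]
      exact algebraMap_star_comm r
    | h₁ z =>
      rw [star_letter, liftAlg_letter, liftAlg_letter]
      cases z <;> simp
    | hm a b h₁ h₂ => rw [star_mul, map_mul, map_mul, star_mul, h₁, h₂]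
    | ha a b h₁ h₂ => rw [star_add, map_add, map_add, star_add, h₁, h₂]

@[simp]
theorem lift_gen [StarModule ℂ B] (f : G → B) (g : G) : lift f (gen g) = f g :=
  liftAlg_letter f (Sum.inl g)

theorem hom_ext {φ ψ : FreeStarAlg G →⋆ₐ[ℂ] B} (h : ∀ g, φ (gen g) = ψ (gen g)) : φ = ψ := by
  ext a
  induction a using induction with
  | h₀ r => rw [AlgHomClass.commutes, AlgHomClass.commutes]
  | h₁ z =>
    rcases z with g | g
    · exact h g
    · have : letter (Sum.inr g) = star (gen g) := (star_letter (Sum.inl g)).symm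
      rw [this, map_star, map_star, h g]
  | hm a b h₁ h₂ => rw [map_mul, map_mul, h₁, h₂]
  | ha a b h₁ h₂ => rw [map_add, map_add, h₁, h₂]

end lift

end FreeStarAlg

/-! ### `C*`-seminorms and completions -/

/-- A `C*`-seminorm on a unital complex `*`-algebra. -/
structure CStarSeminorm (A : Type*) [Ring A] [StarRing A] [Algebra ℂ A] extends
    Seminorm ℂ A where
  mul_le' : ∀ a b, toFun (a * b) ≤ toFun a * toFun b
  star_mul_self' : ∀ a, toFun (star a * a) = toFun a * toFun a

namespace CStarSeminorm

variable {A : Type*} [Ring A] [StarRing A] [Algebra ℂ A]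

instance : CoeFun (CStarSeminorm A) fun _ => A → ℝ := ⟨fun p => p.toFun⟩

theorem nonneg (p : CStarSeminorm A) (a : A) : 0 ≤ p a := apply_nonneg p.toSeminorm a

theorem star_eq (p : CStarSeminorm A) (a : A) : p (star a) = p a := by
  have key : ∀ a, p a ≤ p (star a) := fun a => by
    rcases (p.nonneg a).eq_or_lt with h | h
    · rw [← h]; exact p.nonneg _
    · have := (p.star_mul_self' a).symm.le.trans (p.mul_le' _ _)
      exact le_of_mul_le_mul_right this h
  refine le_antisymm ?_ (key a)
  simpa using key (star a)

/-- The algebra `A`, to be endowed with the topology of the seminorm `p`. -/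
@[nolint unusedArguments]
def Pre (_ : CStarSeminorm A) : Type _ := A

variable (p : CStarSeminorm A)

instance : Ring p.Pre := inferInstanceAs (Ring A)
instance : PseudoMetricSpace p.Pre :=
  p.toSeminorm.toAddGroupSeminorm.toSeminormedAddCommGroup.toPseudoMetricSpace
instance : Norm p.Pre := ⟨p.toFun⟩
instance : StarRing p.Pre := inferInstanceAs (StarRing A)
instance : Algebra ℂ p.Pre := inferInstanceAs (Algebra ℂ A)

instance : SeminormedRing p.Pre where
  dist_eq := p.toSeminorm.toAddGroupSeminorm.toSeminormedAddCommGroup.dist_eq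
  norm_mul_le := p.mul_le'

theorem norm_def (a : p.Pre) : ‖a‖ = p a := rfl

instance : NormedAlgebra ℂ p.Pre where
  __ := (inferInstance : Algebra ℂ p.Pre)
  norm_smul_le c a := (map_smul_eq_mul p.toSeminorm c a).le

theorem norm_star_pre (a : p.Pre) : ‖star a‖ = ‖a‖ := p.star_eq a

theorem star_isometry : Isometry (star : p.Pre → p.Pre) :=
  AddMonoidHomClass.isometry_of_norm (starAddEquiv : p.Pre ≃+ p.Pre) p.norm_star_pre

/-- The completion of `A` in the seminorm `p` (after dividing by the null space of `p`). -/
abbrev Compl : Type _ := Completion p.Pre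

instance : NormedAlgebra ℂ p.Compl where
  norm_smul_le := norm_smul_le

/-- The canonical map from `A` to its completion. -/
def coe (a : A) : p.Compl := ((show p.Pre from a : p.Pre) : Completion p.Pre)

theorem norm_coe (a : A) : ‖p.coe a‖ = p a := Completion.norm_coe (E := p.Pre) a
theorem coe_add (a b : A) : p.coe (a + b) = p.coe a + p.coe b := Completion.coe_add (α := p.Pre) a b
theorem coe_mul (a b : A) : p.coe (a * b) = p.coe a * p.coe b := Completion.coe_mul (α := p.Pre) a b
theorem coe_smul (c : ℂ) (a : A) : p.coe (c • a) = c • p.coe a :=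
  Completion.coe_smul (X := p.Pre) c a
theorem coe_one : p.coe 1 = 1 := rfl

theorem compl_induction {P : p.Compl → Prop} (x : p.Compl) (hc : IsClosed {x | P x})
    (h : ∀ a, P (p.coe a)) : P x := Completion.induction_on (α := p.Pre) x hc h

theorem compl_induction₂ {P : p.Compl → p.Compl → Prop} (x y : p.Compl)
    (hc : IsClosed {x : p.Compl × p.Compl | P x.1 x.2})
    (h : ∀ a b, P (p.coe a) (p.coe b)) : P x y :=
  Completion.induction_on₂ (α := p.Pre) (β := p.Pre) x y hc h

theorem dense_coe : DenseRange p.coe := Completion.denseRange_coe (α := p.Pre)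

instance : Star p.Compl := ⟨(Completion.map star : Completion p.Pre → Completion p.Pre)⟩

theorem coe_star (a : A) : p.coe (star a) = star (p.coe a) :=
  (Completion.map_coe (α := p.Pre) p.star_isometry.uniformContinuous a).symm

theorem continuous_star : Continuous (star : p.Compl → p.Compl) :=
  Completion.continuous_map (α := p.Pre) (f := star)

instance : StarRing p.Compl where
  star_involutive x := by
    induction x using p.compl_induction with
    | hc => exact isClosed_eq (p.continuous_star.comp p.continuous_star) continuous_id
    | h a => rw [← coe_star, ← coe_star, star_star]
  star_mul x y := by
    have := p.continuous_star
    induction x, y using p.compl_induction₂ with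
    | hc => apply isClosed_eq <;> fun_prop
    | h a b => rw [← coe_mul, ← coe_star, ← coe_star, ← coe_star, star_mul, coe_mul]
  star_add x y := by
    have := p.continuous_star
    induction x, y using p.compl_induction₂ with
    | hc => apply isClosed_eq <;> fun_prop
    | h a b => rw [← coe_add, ← coe_star, ← coe_star, ← coe_star, star_add, coe_add]

instance [StarModule ℂ A] : StarModule ℂ p.Compl where
  star_smul c x := by
    induction x using p.compl_induction with
    | hc =>
      exact isClosed_eq (p.continuous_star.comp (continuous_const_smul c))
        (p.continuous_star.const_smul (star c))
    | h a => rw [← coe_smul, ← coe_star, ← coe_star, star_smul, coe_smul]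

instance : CStarRing p.Compl where
  norm_mul_self_le x := by
    induction x using p.compl_induction with
    | hc =>
      exact isClosed_le (continuous_norm.mul continuous_norm)
        (continuous_norm.comp (p.continuous_star.mul continuous_id))
    | h a =>
      rw [← coe_star, ← coe_mul, norm_coe, norm_coe]
      exact (p.star_mul_self' a).symm.le

instance [StarModule ℂ A] : CStarAlgebra p.Compl where

/-- The canonical `*`-homomorphism from `A` to its completion. -/
def coeHom [StarModule ℂ A] : A →⋆ₐ[ℂ] p.Compl where
  toFun := p.coe
  map_one' := p.coe_one
  map_mul' := p.coe_mul
  map_zero' := rfl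
  map_add' := p.coe_add
  commutes' c := by
    rw [Algebra.algebraMap_eq_smul_one, coe_smul, coe_one, Algebra.algebraMap_eq_smul_one]
  map_star' := p.coe_star

section extend

variable [StarModule ℂ A] {B : Type*} [CStarAlgebra B]

/-- A `*`-homomorphism to a `C*`-algebra that is bounded by `p` extends to the completion. -/
def extend (f : A →⋆ₐ[ℂ] B) (hf : ∀ a, ‖f a‖ ≤ p a) : p.Compl →⋆ₐ[ℂ] B :=
  let L : p.Pre →L[ℂ] B := LinearMap.mkContinuous (f.toAlgHom.toLinearMap : A →ₗ[ℂ] B) 1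
    (fun a => by rw [one_mul]; exact hf a)
  let F : p.Compl →L[ℂ] B := (L.fromCompletion : Completion p.Pre →L[ℂ] B)
  have hF : ∀ a : A, F (p.coe a) = f a := fun a => L.fromCompletion_apply_coe (show p.Pre from a)
  { toFun := F
    map_one' := by rw [← coe_one, hF, map_one]
    map_mul' := fun x y => by
      induction x, y using p.compl_induction₂ with
      | hc => apply isClosed_eq <;> fun_prop
      | h a b => rw [← coe_mul, hF, hF, hF, map_mul]
    map_zero' := map_zero F
    map_add' := map_add F
    commutes' := fun c => by
      rw [Algebra.algebraMap_eq_smul_one, map_smul, ← coe_one, hF, map_one,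
        Algebra.algebraMap_eq_smul_one]
    map_star' := fun x => by
      have := p.continuous_star
      induction x using p.compl_induction with
      | hc => apply isClosed_eq <;> fun_prop
      | h a => rw [← coe_star, hF, hF, map_star] }

@[simp]
theorem extend_coe (f : A →⋆ₐ[ℂ] B) (hf : ∀ a, ‖f a‖ ≤ p a) (a : A) :
    p.extend f hf (p.coe a) = f a :=
  ContinuousLinearMap.fromCompletion_apply_coe (α := p.Pre) _ a

end extend

/-- The `C*`-seminorm that a `*`-homomorphism to a `C*`-algebra induces. -/
def ofHom {B : Type*} [CStarAlgebra B] (f : A →⋆ₐ[ℂ] B) : CStarSeminorm A where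
  __ := (normSeminorm ℂ B).comp f.toAlgHom.toLinearMap
  mul_le' a b := by
    change ‖f (a * b)‖ ≤ ‖f a‖ * ‖f b‖
    rw [map_mul]; exact norm_mul_le _ _
  star_mul_self' a := by
    change ‖f (star a * a)‖ = ‖f a‖ * ‖f a‖
    rw [map_mul, map_star]; exact CStarRing.norm_star_mul_self

theorem ofHom_apply {B : Type*} [CStarAlgebra B] (f : A →⋆ₐ[ℂ] B) (a : A) :
    ofHom f a = ‖f a‖ := rfl

end CStarSeminorm

theorem continuous_starAlgHom {A B : Type*} [CStarAlgebra A] [CStarAlgebra B]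
    (f : A →⋆ₐ[ℂ] B) : Continuous f :=
  AddMonoidHomClass.continuous_of_bound f 1 fun x => by
    rw [one_mul]; exact NonUnitalStarAlgHom.norm_apply_le f x

/-! ### Universal unital `C*`-algebras given by generators and relations -/

section Universal

variable {G : Type*}

/-- The `C*`-seminorms on the free `*`-algebra on `G` that vanish on the relators in `R`, that is,
the `C*`-seminorms on the universal unital `*`-algebra with generators `G` and relations `R`. -/
def AdmissibleSeminorm (R : Set (FreeStarAlg G)) : Type _ :=
  {p : CStarSeminorm (FreeStarAlg G) // ∀ r ∈ R, p r = 0}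

instance (R : Set (FreeStarAlg G)) : Nonempty (AdmissibleSeminorm R) :=
  ⟨{ toSeminorm := 0
     mul_le' := fun _ _ => (mul_zero (0 : ℝ)).ge
     star_mul_self' := fun _ => (mul_zero (0 : ℝ)).symm }, fun _ _ => rfl⟩

/-- On each generator, the admissible `C*`-seminorms are uniformly bounded. -/
def IsBoundedPresentation (R : Set (FreeStarAlg G)) : Prop :=
  ∀ g : G, ∃ C : ℝ, ∀ p : AdmissibleSeminorm R, p.1 (FreeStarAlg.gen g) ≤ C

variable {R : Set (FreeStarAlg G)}

theorem AdmissibleSeminorm.bddAbove (hR : IsBoundedPresentation R) (a : FreeStarAlg G) :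
    BddAbove (Set.range fun p : AdmissibleSeminorm R => p.1 a) := by
  suffices h : ∃ C : ℝ, ∀ p : AdmissibleSeminorm R, p.1 a ≤ C by
    obtain ⟨C, hC⟩ := h
    exact ⟨C, by rintro _ ⟨p, rfl⟩; exact hC p⟩
  induction a using FreeStarAlg.induction with
  | h₀ r =>
    refine ⟨‖r‖ * 1, fun p => ?_⟩
    rw [Algebra.algebraMap_eq_smul_one]
    refine (map_smul_eq_mul p.1.toSeminorm r 1).le.trans ?_
    refine mul_le_mul_of_nonneg_left ?_ (norm_nonneg _)
    have h := p.1.star_mul_self' 1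
    rw [star_one, one_mul] at h
    change p.1 1 ≤ 1
    have h0 := p.1.nonneg 1
    nlinarith
  | h₁ z =>
    rcases z with g | g
    · exact hR g
    · obtain ⟨C, hC⟩ := hR g
      refine ⟨C, fun p => ?_⟩
      rw [← p.1.star_eq, FreeStarAlg.star_letter]
      exact hC p
  | hm a b h₁ h₂ =>
    obtain ⟨C₁, h₁⟩ := h₁
    obtain ⟨C₂, h₂⟩ := h₂
    refine ⟨C₁ * C₂, fun p => (p.1.mul_le' a b).trans ?_⟩
    exact mul_le_mul (h₁ p) (h₂ p) (p.1.nonneg b) ((p.1.nonneg a).trans (h₁ p))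
  | ha a b h₁ h₂ =>
    obtain ⟨C₁, h₁⟩ := h₁
    obtain ⟨C₂, h₂⟩ := h₂
    exact ⟨C₁ + C₂, fun p =>
      (map_add_le_add p.1.toSeminorm a b).trans (add_le_add (h₁ p) (h₂ p))⟩

/-- The largest `C*`-seminorm on the universal unital `*`-algebra with generators `G` and
relations `R`. -/
def maxSeminorm (hR : IsBoundedPresentation R) : CStarSeminorm (FreeStarAlg G) where
  toFun a := ⨆ p : AdmissibleSeminorm R, p.1 a
  map_zero' := by
    have : ∀ p : AdmissibleSeminorm R, p.1 0 = 0 := fun p => map_zero p.1.toSeminorm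
    simp [this]
  add_le' a b := ciSup_le fun p => (map_add_le_add p.1.toSeminorm a b).trans <|
    add_le_add (le_ciSup (AdmissibleSeminorm.bddAbove hR a) p)
      (le_ciSup (AdmissibleSeminorm.bddAbove hR b) p)
  neg' a := by
    have : ∀ p : AdmissibleSeminorm R, p.1 (-a) = p.1 a := fun p => map_neg_eq_map p.1.toSeminorm a
    simp [this]
  smul' c a := by
    rw [Real.mul_iSup_of_nonneg (norm_nonneg c)]
    exact iSup_congr fun p => map_smul_eq_mul p.1.toSeminorm c a
  mul_le' a b := ciSup_le fun p => (p.1.mul_le' a b).trans <|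
    mul_le_mul (le_ciSup (AdmissibleSeminorm.bddAbove hR a) p)
      (le_ciSup (AdmissibleSeminorm.bddAbove hR b) p) (p.1.nonneg b)
      (Real.iSup_nonneg fun p => p.1.nonneg a)
  star_mul_self' a := by
    refine le_antisymm (ciSup_le fun p => ?_) ?_
    · rw [p.1.star_mul_self']
      exact mul_self_le_mul_self (p.1.nonneg a) (le_ciSup (AdmissibleSeminorm.bddAbove hR a) p)
    · have h0 : (0 : ℝ) ≤ ⨆ p : AdmissibleSeminorm R, p.1 (star a * a) :=
        Real.iSup_nonneg fun p => p.1.nonneg _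
      suffices h : (⨆ p : AdmissibleSeminorm R, p.1 a) ≤
          √(⨆ p : AdmissibleSeminorm R, p.1 (star a * a)) by
        calc (⨆ p : AdmissibleSeminorm R, p.1 a) * (⨆ p : AdmissibleSeminorm R, p.1 a)
            ≤ √(⨆ p : AdmissibleSeminorm R, p.1 (star a * a)) *
              √(⨆ p : AdmissibleSeminorm R, p.1 (star a * a)) :=
              mul_self_le_mul_self (Real.iSup_nonneg fun p => p.1.nonneg a) h
          _ = _ := Real.mul_self_sqrt h0
      refine ciSup_le fun p => ?_
      refine Real.le_sqrt_of_sq_le ?_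
      rw [sq, ← p.1.star_mul_self']
      exact le_ciSup (AdmissibleSeminorm.bddAbove hR (star a * a)) p

/-- The universal unital `C*`-algebra with generators `G` and relations `r = 0` for `r ∈ R`. -/
def UnivCStar (hR : IsBoundedPresentation R) : Type _ := (maxSeminorm hR).Compl

namespace UnivCStar

variable (hR : IsBoundedPresentation R)

instance : CStarAlgebra (UnivCStar hR) := inferInstanceAs (CStarAlgebra (maxSeminorm hR).Compl)

/-- The canonical map from the free `*`-algebra to the universal `C*`-algebra. -/
def mk : FreeStarAlg G →⋆ₐ[ℂ] UnivCStar hR := (maxSeminorm hR).coeHom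

/-- The generators of the universal `C*`-algebra. -/
def gen (g : G) : UnivCStar hR := mk hR (FreeStarAlg.gen g)

theorem dense_mk : DenseRange (mk hR) := (maxSeminorm hR).dense_coe

theorem mk_eq_zero {r : FreeStarAlg G} (hr : r ∈ R) : mk hR r = 0 := by
  refine norm_eq_zero.mp (((maxSeminorm hR).norm_coe r).trans ?_)
  exact (iSup_congr fun p : AdmissibleSeminorm R => p.2 r hr).trans ciSup_const

variable {B : Type*} [CStarAlgebra B]

/-- The universal property. -/
def lift (f : G → B) (hf : ∀ r ∈ R, FreeStarAlg.lift f r = 0) : UnivCStar hR →⋆ₐ[ℂ] B :=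
  (maxSeminorm hR).extend (FreeStarAlg.lift f) fun a =>
    le_ciSup (AdmissibleSeminorm.bddAbove hR a)
      ⟨CStarSeminorm.ofHom (FreeStarAlg.lift f), fun r hr => norm_eq_zero.mpr (hf r hr)⟩

@[simp]
theorem lift_gen (f : G → B) (hf : ∀ r ∈ R, FreeStarAlg.lift f r = 0) (g : G) :
    lift hR f hf (gen hR g) = f g :=
  ((maxSeminorm hR).extend_coe (FreeStarAlg.lift f) _ (FreeStarAlg.gen g)).trans
    (FreeStarAlg.lift_gen f g)

theorem hom_ext {φ ψ : UnivCStar hR →⋆ₐ[ℂ] B} (h : ∀ g, φ (gen hR g) = ψ (gen hR g)) :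
    φ = ψ := by
  have h₁ : φ.comp (mk hR) = ψ.comp (mk hR) := FreeStarAlg.hom_ext h
  refine DFunLike.coe_injective
    ((dense_mk hR).equalizer (continuous_starAlgHom φ) (continuous_starAlgHom ψ) ?_)
  exact congrArg DFunLike.coe h₁

end UnivCStar

theorem isBoundedPresentation_of_norm_le {G : Type*} {R : Set (FreeStarAlg G)}
    (h : ∀ p : CStarSeminorm (FreeStarAlg G), (∀ r ∈ R, p.coeHom r = 0) →
      ∀ g, ‖p.coeHom (FreeStarAlg.gen g)‖ ≤ 1) : IsBoundedPresentation R := fun g =>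
  ⟨1, fun p => by
    rw [← p.1.norm_coe]
    exact h p.1 (fun r hr => norm_eq_zero.mp ((p.1.norm_coe r).trans (p.2 r hr))) g⟩

end Universal

section Unitary

theorem norm_le_one_of_sum_star_mul_self {ι B : Type*} [Fintype ι] [CStarAlgebra B]
    (a : ι → B) (h : ∑ k, star (a k) * a k = 1) (k : ι) : ‖a k‖ ≤ 1 := by
  let := CStarAlgebra.spectralOrder B
  have := CStarAlgebra.spectralOrderedRing B
  rcases subsingleton_or_nontrivial B with hB | hB
  · rw [Subsingleton.elim (a k) 0, norm_zero]; exact zero_le_one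
  have h₁ : star (a k) * a k ≤ 1 := by
    rw [← h]
    exact Finset.single_le_sum (f := fun k => star (a k) * a k)
      (fun i _ => star_mul_self_nonneg (a i)) (Finset.mem_univ k)
  have h₂ : ‖star (a k) * a k‖ ≤ 1 :=
    (CStarAlgebra.norm_le_one_iff_of_nonneg _ (star_mul_self_nonneg _)).mpr h₁
  rw [CStarRing.norm_star_mul_self] at h₂
  nlinarith [norm_nonneg (a k)]

end Unitary

/-! ### `ℤ/N`-`C*`-algebras -/

section Coaction

/-- The function `t ↦ ω ^ t` on `ℤ/N`, for an `N`-th root of unity `ω`. -/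
def chi {N : ℕ} (ω : ℂ) (t : ZMod N) : ℂ := ω ^ t.val

/-- A coaction of `C(ℤ/N)` on a unital `C*`-algebra `X`, that is, a unital `*`-homomorphism
`ρ : X → X ⊗ C(ℤ/N) = C(ℤ/N, X)` which satisfies `(ρ ⊗ id) ρ = (id ⊗ Δ) ρ` and for which the
closed linear span of `ρ(X) (1 ⊗ C(ℤ/N))` is `X ⊗ C(ℤ/N)`.  A `ℤ/N`-`C*`-algebra is a unital
`C*`-algebra with such a coaction. -/
structure Coaction (N : ℕ) [NeZero N] (X : Type*) [CStarAlgebra X] where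
  hom : X →⋆ₐ[ℂ] (ZMod N → X)
  coassoc : ∀ x s t, hom (hom x t) s = hom x (s + t)
  podles : Dense (Submodule.span ℂ
    {h : ZMod N → X | ∃ (x : X) (f : ZMod N → ℂ), h = fun t => f t • hom x t} :
      Set (ZMod N → X))

/-- A `*`-homomorphism `ρ : X → C(ℤ/N, X)` that comes from an action of `ℤ/N` by automorphisms is a
coaction. -/
def Coaction.ofAction {N : ℕ} [NeZero N] {X : Type*} [CStarAlgebra X]
    (ρ : X →⋆ₐ[ℂ] (ZMod N → X)) (h₀ : ∀ x, ρ x 0 = x)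
    (h₁ : ∀ x s t, ρ (ρ x t) s = ρ x (s + t)) : Coaction N X where
  hom := ρ
  coassoc := h₁
  podles := by
    intro f
    refine subset_closure ?_
    have hf : f = ∑ s : ZMod N, fun t => (if t = s then (1 : ℂ) else 0) • ρ (ρ (f s) (-s)) t := by
      funext t
      simp [Finset.sum_apply, h₁, h₀, ite_smul]
    rw [hf]
    exact Submodule.sum_mem _ fun s _ =>
      Submodule.subset_span ⟨ρ (f s) (-s), fun t => if t = s then 1 else 0, rfl⟩

variable {N : ℕ} [NeZero N] {X Y : Type*} [CStarAlgebra X] [CStarAlgebra Y]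

/-- The `ℤ/N`-equivariant morphisms between two `ℤ/N`-`C*`-algebras: the unital
`*`-homomorphisms `φ` with `ρ^Y φ = (φ ⊗ id) ρ^X`. -/
structure EquivariantHom (ρX : Coaction N X) (ρY : Coaction N Y) extends X →⋆ₐ[ℂ] Y where
  equivariant : ∀ x t, ρY.hom (toStarAlgHom x) t = toStarAlgHom (ρX.hom x t)

instance {ρX : Coaction N X} {ρY : Coaction N Y} :
    CoeFun (EquivariantHom ρX ρY) fun _ => X → Y := ⟨fun φ => φ.toStarAlgHom⟩

/-- A homogeneous element of degree `d`: `ρ_t(x) = ω ^ (t d) x`. -/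
def IsHomogeneous (ω : ℂ) (ρ : Coaction N X) (d : ZMod N) (x : X) : Prop :=
  ∀ t, ρ.hom x t = chi ω (t * d) • x

end Coaction

section Chi

variable {N : ℕ} [NeZero N] {ω : ℂ}

theorem chi_natCast (hω : IsPrimitiveRoot ω N) (n : ℕ) : chi ω (n : ZMod N) = ω ^ n := by
  rw [chi, ZMod.val_natCast, ← pow_mod_orderOf ω n, ← hω.eq_orderOf]

theorem chi_add (hω : IsPrimitiveRoot ω N) (s t : ZMod N) : chi ω (s + t) = chi ω s * chi ω t := by
  rw [← ZMod.natCast_zmod_val s, ← ZMod.natCast_zmod_val t, ← Nat.cast_add, chi_natCast hω,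
    chi_natCast hω, chi_natCast hω, pow_add]

theorem chi_zero : chi ω (0 : ZMod N) = 1 := by simp [chi]

theorem chi_neg_mul_self (hω : IsPrimitiveRoot ω N) (s : ZMod N) : chi ω (-s) * chi ω s = 1 := by
  rw [← chi_add hω, neg_add_cancel, chi_zero]

theorem chi_conj (hω : IsPrimitiveRoot ω N) (s : ZMod N) : conj (chi ω s) = chi ω (-s) := by
  have h₁ : ‖chi ω s‖ = 1 := by
    rw [chi, norm_pow, hω.norm'_eq_one (NeZero.ne N), one_pow]
  have h₂ : conj (chi ω s) * chi ω s = 1 := by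
    rw [Complex.conj_mul', h₁]; simp
  have h₃ : chi ω s ≠ 0 := fun h => by simp [h] at h₁
  exact mul_right_cancel₀ h₃ (h₂.trans (chi_neg_mul_self hω s).symm)

theorem chi_star (hω : IsPrimitiveRoot ω N)
    (s : ZMod N) : star (chi ω s) = chi ω (-s) := chi_conj hω s

theorem sum_chi_mul (hω : IsPrimitiveRoot ω N) (a : ZMod N) :
    ∑ t : ZMod N, chi ω (t * a) = if a = 0 then (N : ℂ) else 0 := by
  split_ifs with ha
  · simp [ha, chi_zero, ZMod.card]
  · have h : chi ω a * ∑ t : ZMod N, chi ω (t * a) = ∑ t : ZMod N, chi ω (t * a) := by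
      rw [Finset.mul_sum, ← Equiv.sum_comp (Equiv.addRight (1 : ZMod N)) fun t => chi ω (t * a)]
      refine Finset.sum_congr rfl fun t _ => ?_
      rw [Equiv.coe_addRight, add_mul, one_mul, chi_add hω, mul_comm]
    have h1 : chi ω a ≠ 1 := by
      intro h1
      have := hω.dvd_of_pow_eq_one a.val h1
      have hlt := ZMod.val_lt a
      have h0 : a.val = 0 := Nat.eq_zero_of_dvd_of_lt this hlt
      exact ha ((ZMod.val_eq_zero a).mp h0)
    by_contra h2
    exact h1 (mul_right_cancel₀ h2 (h.trans (one_mul _).symm))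

end Chi

/-! ### Hilbert space tensor products -/

section Tensor

universe u v

/-- The Hilbert space tensor product. -/
abbrev HTensor (H : Type*) (K : Type*) [NormedAddCommGroup H] [InnerProductSpace ℂ H]
    [NormedAddCommGroup K] [InnerProductSpace ℂ K] : Type _ := Completion (H ⊗[ℂ] K)

variable {H K L : Type*} [NormedAddCommGroup H] [InnerProductSpace ℂ H]
  [NormedAddCommGroup K] [InnerProductSpace ℂ K] [NormedAddCommGroup L] [InnerProductSpace ℂ L]

instance [Nontrivial H] [Nontrivial K] : Nontrivial (HTensor H K) := by
  obtain ⟨x, hx⟩ := exists_ne (0 : H)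
  obtain ⟨y, hy⟩ := exists_ne (0 : K)
  refine ⟨⟨((x ⊗ₜ[ℂ] y : H ⊗[ℂ] K) : HTensor H K), 0, fun h => ?_⟩⟩
  have := congrArg norm h
  rw [Completion.norm_coe, TensorProduct.norm_tmul, norm_zero] at this
  exact mul_ne_zero (norm_ne_zero_iff.mpr hx) (norm_ne_zero_iff.mpr hy) this

theorem HTensor.ext {F : Type*} [NormedAddCommGroup F] [NormedSpace ℂ F]
    {S T : HTensor H K →L[ℂ] F}
    (h : ∀ (x : H) (y : K), S (x ⊗ₜ[ℂ] y : H ⊗[ℂ] K) = T (x ⊗ₜ[ℂ] y : H ⊗[ℂ] K)) : S = T := by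
  ext z
  induction z using Completion.induction_on with
  | hp => exact isClosed_eq S.continuous T.continuous
  | ih z =>
    induction z using TensorProduct.induction_on with
    | zero => rw [Completion.coe_zero, map_zero, map_zero]
    | tmul x y => exact h x y
    | add a b ha hb => rw [Completion.coe_add, map_add, map_add, ha, hb]

variable (K) in
/-- The map `T ↦ T ⊗ 1` from operators on `H` to operators on `H ⊗ K`. -/
def ampl [CompleteSpace H] : (H →L[ℂ] H) →⋆ₐ[ℂ] (HTensor H K →L[ℂ] HTensor H K) where
  toFun T := (T.rTensor K).completion
  map_one' := HTensor.ext fun x y => by simp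
  map_mul' S T := HTensor.ext fun x y => by simp
  map_zero' := HTensor.ext fun x y => by simp
  map_add' S T := HTensor.ext fun x y => by
    simp [Completion.coe_add]
  commutes' c := HTensor.ext fun x y => by
    rw [Algebra.algebraMap_eq_smul_one, Algebra.algebraMap_eq_smul_one]
    simp
  map_star' T := by
    rw [ContinuousLinearMap.star_eq_adjoint, ContinuousLinearMap.star_eq_adjoint,
      ContinuousLinearMap.eq_adjoint_iff]
    intro a b
    induction a, b using Completion.induction_on₂ with
    | hp => exact isClosed_eq (by fun_prop) (by fun_prop)
    | ih a b =>
      rw [ContinuousLinearMap.completion_apply_coe, ContinuousLinearMap.completion_apply_coe,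
        Completion.inner_coe, Completion.inner_coe]
      induction a using TensorProduct.induction_on with
      | zero => simp
      | add a a' h h' => rw [map_add, inner_add_left, inner_add_left, h, h']
      | tmul x y =>
        induction b using TensorProduct.induction_on with
        | zero => simp
        | add a a' h h' => rw [map_add, inner_add_right, inner_add_right, h, h']
        | tmul x' y' => simp [ContinuousLinearMap.adjoint_inner_left]

@[simp]
theorem ampl_tmul [CompleteSpace H] (T : H →L[ℂ] H) (x : H) (y : K) :
    ampl K T ((x ⊗ₜ[ℂ] y : H ⊗[ℂ] K) : HTensor H K) = (T x ⊗ₜ[ℂ] y : H ⊗[ℂ] K) :=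
  (T.rTensor K).completion_apply_coe (x ⊗ₜ[ℂ] y)

/-- The extension of a linear isometric isomorphism to the completions. -/
def complIso {E F : Type*} [NormedAddCommGroup E] [InnerProductSpace ℂ E]
    [NormedAddCommGroup F] [InnerProductSpace ℂ F] (e : E ≃ₗᵢ[ℂ] F) :
    Completion E ≃ₗᵢ[ℂ] Completion F where
  toFun := (e.toContinuousLinearEquiv : E →L[ℂ] F).completion
  map_add' := map_add _
  map_smul' := map_smul _
  invFun := (e.symm.toContinuousLinearEquiv : F →L[ℂ] E).completion
  left_inv x := by
    induction x using Completion.induction_on with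
    | hp => exact isClosed_eq (by fun_prop) (by fun_prop)
    | ih a => simp
  right_inv x := by
    induction x using Completion.induction_on with
    | hp => exact isClosed_eq (by fun_prop) (by fun_prop)
    | ih a => simp
  norm_map' x := by
    change ‖(e.toContinuousLinearEquiv : E →L[ℂ] F).completion x‖ = ‖x‖
    induction x using Completion.induction_on with
    | hp => exact isClosed_eq (by fun_prop) (by fun_prop)
    | ih a => simp

theorem complIso_coe {E F : Type*} [NormedAddCommGroup E] [InnerProductSpace ℂ E]
    [NormedAddCommGroup F] [InnerProductSpace ℂ F] (e : E ≃ₗᵢ[ℂ] F) (x : E) :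
    complIso e (x : Completion E) = (e x : F) :=
  (e.toContinuousLinearEquiv : E →L[ℂ] F).completion_apply_coe x

end Tensor

/-! ### The braiding -/

section Braiding

variable {N : ℕ} [NeZero N] {ω : ℂ} {H K : Type*} [NormedAddCommGroup H] [InnerProductSpace ℂ H]
  [NormedAddCommGroup K] [InnerProductSpace ℂ K]

/-- The projection of a unitary representation `U` of `ℤ/N` onto its subspace of degree `m`, on
which `U t` is the multiplication by `ω ^ (t m)`. -/
def degreeProj (ω : ℂ) (U : Multiplicative (ZMod N) →* (H ≃ₗᵢ[ℂ] H)) (m : ZMod N) : H →ₗ[ℂ] H :=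
  (N : ℂ)⁻¹ • ∑ t : ZMod N, chi ω (-(t * m)) • (U (.ofAdd t)).toLinearEquiv.toLinearMap

theorem degreeProj_apply (U : Multiplicative (ZMod N) →* (H ≃ₗᵢ[ℂ] H)) (m : ZMod N) (x : H) :
    degreeProj ω U m x = (N : ℂ)⁻¹ • ∑ t : ZMod N, chi ω (-(t * m)) • U (.ofAdd t) x := by
  simp [degreeProj, LinearMap.sum_apply]

theorem unitary_add (U : Multiplicative (ZMod N) →* (H ≃ₗᵢ[ℂ] H)) (s t : ZMod N) (x : H) :
    U (.ofAdd (s + t)) x = U (.ofAdd s) (U (.ofAdd t) x) := by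
  rw [ofAdd_add, map_mul]; rfl

theorem unitary_zero (U : Multiplicative (ZMod N) →* (H ≃ₗᵢ[ℂ] H)) (x : H) :
    U (.ofAdd 0) x = x := by
  rw [ofAdd_zero, map_one]; rfl

theorem unitary_inner (U : Multiplicative (ZMod N) →* (H ≃ₗᵢ[ℂ] H)) (t : ZMod N) (x y : H) :
    inner ℂ (U (.ofAdd t) x) y = inner ℂ x (U (.ofAdd (-t)) y) := by
  rw [← (U (.ofAdd t)).inner_map_map x, ← unitary_add, add_neg_cancel, unitary_zero]

section


theorem degreeProj_unitary (hω : IsPrimitiveRoot ω N)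
    (U : Multiplicative (ZMod N) →* (H ≃ₗᵢ[ℂ] H)) (m s : ZMod N) (x : H) :
    degreeProj ω U m (U (.ofAdd s) x) = chi ω (s * m) • degreeProj ω U m x := by
  rw [degreeProj_apply, degreeProj_apply, smul_comm (chi ω (s * m))]
  congr 1
  rw [Finset.smul_sum, ← Equiv.sum_comp (Equiv.addRight s) fun t =>
      chi ω (s * m) • chi ω (-(t * m)) • U (.ofAdd t) x]
  refine Finset.sum_congr rfl fun t _ => ?_
  rw [Equiv.coe_addRight, unitary_add, smul_smul, ← chi_add hω]
  congr 2
  ring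

theorem unitary_degreeProj (hω : IsPrimitiveRoot ω N)
    (U : Multiplicative (ZMod N) →* (H ≃ₗᵢ[ℂ] H)) (m s : ZMod N) (x : H) :
    U (.ofAdd s) (degreeProj ω U m x) = chi ω (s * m) • degreeProj ω U m x := by
  rw [← degreeProj_unitary hω, degreeProj_apply, degreeProj_apply, map_smul, map_sum]
  congr 1
  refine Finset.sum_congr rfl fun t _ => ?_
  rw [map_smul, ← unitary_add, ← unitary_add, add_comm]

theorem degreeProj_degreeProj (hω : IsPrimitiveRoot ω N)
    (U : Multiplicative (ZMod N) →* (H ≃ₗᵢ[ℂ] H)) (m n : ZMod N)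
    (x : H) :
    degreeProj ω U n (degreeProj ω U m x) = if m = n then degreeProj ω U m x else 0 := by
  rw [degreeProj_apply (m := n)]
  simp only [unitary_degreeProj hω, smul_smul, ← chi_add hω]
  have h : ∀ t : ZMod N, -(t * n) + t * m = t * (m - n) := fun t => by ring
  simp only [h]
  rw [← Finset.sum_smul, sum_chi_mul hω]
  simp only [sub_eq_zero]
  split_ifs
  · rw [smul_smul, inv_mul_cancel₀ (Nat.cast_ne_zero.mpr (NeZero.ne N)), one_smul]
  · simp

theorem sum_degreeProj (hω : IsPrimitiveRoot ω N)
    (U : Multiplicative (ZMod N) →* (H ≃ₗᵢ[ℂ] H)) (x : H) :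
    ∑ m : ZMod N, degreeProj ω U m x = x := by
  simp only [degreeProj_apply]
  rw [← Finset.smul_sum, Finset.sum_comm]
  simp only [← Finset.sum_smul]
  have h : ∀ t m : ZMod N, -(t * m) = m * (-t) := fun t m => by ring
  simp only [h, sum_chi_mul hω, neg_eq_zero, ite_smul, zero_smul]
  rw [Finset.sum_ite_eq' Finset.univ (0 : ZMod N), if_pos (Finset.mem_univ _), unitary_zero,
    smul_smul, inv_mul_cancel₀ (Nat.cast_ne_zero.mpr (NeZero.ne N)), one_smul]

theorem degreeProj_of_degree (hω : IsPrimitiveRoot ω N)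
    (U : Multiplicative (ZMod N) →* (H ≃ₗᵢ[ℂ] H)) (m n : ZMod N) (x : H)
    (hx : ∀ t, U (.ofAdd t) x = chi ω (t * m) • x) :
    degreeProj ω U n x = if m = n then x else 0 := by
  have h : degreeProj ω U m x = x := by
    rw [degreeProj_apply]
    simp only [hx, smul_smul, chi_neg_mul_self hω, one_smul, Finset.sum_const, Finset.card_univ,
      ZMod.card, ← Nat.cast_smul_eq_nsmul ℂ]
    rw [inv_mul_cancel₀ (Nat.cast_ne_zero.mpr (NeZero.ne N)), one_smul]
  rw [← h, degreeProj_degreeProj hω]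

theorem degreeProj_inner (hω : IsPrimitiveRoot ω N)
    (U : Multiplicative (ZMod N) →* (H ≃ₗᵢ[ℂ] H)) (m : ZMod N) (x y : H) :
    inner ℂ (degreeProj ω U m x) y = inner ℂ x (degreeProj ω U m y) := by
  simp only [degreeProj_apply, inner_smul_left, inner_smul_right, sum_inner, inner_sum,
    unitary_inner, chi_conj hω]
  congr 1
  · simp
  · rw [← Equiv.sum_comp (Equiv.neg (ZMod N))]
    refine Finset.sum_congr rfl fun t _ => ?_
    simp

end

/-- The map `ξ ⊗ η ↦ ∑ₘ Pₘ ξ ⊗ V (e m) η`, with `Pₘ` the projection onto the degree `m`. -/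
def twistMap (ω : ℂ) (U : Multiplicative (ZMod N) →* (H ≃ₗᵢ[ℂ] H))
    (V : Multiplicative (ZMod N) →* (K ≃ₗᵢ[ℂ] K)) (e : ZMod N) : H ⊗[ℂ] K →ₗ[ℂ] H ⊗[ℂ] K :=
  ∑ m : ZMod N, TensorProduct.map (degreeProj ω U m) (V (.ofAdd (e * m))).toLinearEquiv.toLinearMap

theorem twistMap_tmul (U : Multiplicative (ZMod N) →* (H ≃ₗᵢ[ℂ] H))
    (V : Multiplicative (ZMod N) →* (K ≃ₗᵢ[ℂ] K)) (e : ZMod N) (x : H) (y : K) :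
    twistMap ω U V e (x ⊗ₜ y) = ∑ m : ZMod N, degreeProj ω U m x ⊗ₜ V (.ofAdd (e * m)) y := by
  simp [twistMap, LinearMap.sum_apply]

theorem twistMap_twistMap (hω : IsPrimitiveRoot ω N) (U : Multiplicative (ZMod N) →* (H ≃ₗᵢ[ℂ] H))
    (V : Multiplicative (ZMod N) →* (K ≃ₗᵢ[ℂ] K)) (e : ZMod N) (z : H ⊗[ℂ] K) :
    twistMap ω U V e (twistMap ω U V (-e) z) = z := by
  induction z using TensorProduct.induction_on with
  | zero => simp
  | add a b ha hb => rw [map_add, map_add, ha, hb]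
  | tmul x y =>
    rw [twistMap_tmul, map_sum]
    simp only [twistMap_tmul, degreeProj_degreeProj hω, TensorProduct.ite_tmul, ← unitary_add]
    simp only [Finset.sum_ite_eq, Finset.mem_univ, if_true, ← add_mul, add_neg_cancel, zero_mul,
      unitary_zero]
    rw [← TensorProduct.sum_tmul, sum_degreeProj hω]

theorem twistMap_inner (hω : IsPrimitiveRoot ω N) (U : Multiplicative (ZMod N) →* (H ≃ₗᵢ[ℂ] H))
    (V : Multiplicative (ZMod N) →* (K ≃ₗᵢ[ℂ] K)) (e : ZMod N) (a b : H ⊗[ℂ] K) :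
    inner ℂ (twistMap ω U V e a) b = inner ℂ a (twistMap ω U V (-e) b) := by
  induction a using TensorProduct.induction_on with
  | zero => simp
  | add a a' h h' => rw [map_add, inner_add_left, inner_add_left, h, h']
  | tmul x y =>
    induction b using TensorProduct.induction_on with
    | zero => simp
    | add a a' h h' => rw [map_add, inner_add_right, inner_add_right, h, h']
    | tmul x' y' =>
      simp only [twistMap_tmul, sum_inner, inner_sum, TensorProduct.inner_tmul,
        degreeProj_inner hω, unitary_inner, neg_mul]

/-- The unitary `ξ ⊗ η ↦ ∑ₘ Pₘ ξ ⊗ V m η`, which multiplies `ξ ⊗ η` with `ω ^ (m n)` if `ξ` has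
degree `m` and `η` has degree `n`. -/
def twist (hω : IsPrimitiveRoot ω N) (U : Multiplicative (ZMod N) →* (H ≃ₗᵢ[ℂ] H))
    (V : Multiplicative (ZMod N) →* (K ≃ₗᵢ[ℂ] K)) : H ⊗[ℂ] K ≃ₗᵢ[ℂ] H ⊗[ℂ] K where
  __ := twistMap ω U V 1
  invFun := twistMap ω U V (-1)
  left_inv z := by
    have := twistMap_twistMap hω U V (-1) z
    rwa [neg_neg] at this
  right_inv z := twistMap_twistMap hω U V 1 z
  norm_map' z := by
    change ‖twistMap ω U V 1 z‖ = ‖z‖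
    have h := twistMap_inner hω U V 1 z (twistMap ω U V 1 z)
    have h' := twistMap_twistMap hω U V (-1) z
    rw [neg_neg] at h'
    rw [h'] at h
    rw [@norm_eq_sqrt_re_inner ℂ, @norm_eq_sqrt_re_inner ℂ _ _ _ _ z, h]

theorem twist_tmul (hω : IsPrimitiveRoot ω N) (U : Multiplicative (ZMod N) →* (H ≃ₗᵢ[ℂ] H))
    (V : Multiplicative (ZMod N) →* (K ≃ₗᵢ[ℂ] K)) (x : H) (y : K) :
    twist hω U V (x ⊗ₜ y) = ∑ m : ZMod N, degreeProj ω U m x ⊗ₜ V (.ofAdd m) y := by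
  refine (twistMap_tmul U V 1 x y).trans ?_
  simp only [one_mul]

/-- The braiding unitary `H ⊗ K → K ⊗ H`. -/
def braiding (hω : IsPrimitiveRoot ω N) (U : Multiplicative (ZMod N) →* (H ≃ₗᵢ[ℂ] H))
    (V : Multiplicative (ZMod N) →* (K ≃ₗᵢ[ℂ] K)) : HTensor H K ≃ₗᵢ[ℂ] HTensor K H :=
  complIso ((twist hω U V).trans (TensorProduct.commIsometry ℂ H K))

theorem braiding_tmul (hω : IsPrimitiveRoot ω N) (U : Multiplicative (ZMod N) →* (H ≃ₗᵢ[ℂ] H))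
    (V : Multiplicative (ZMod N) →* (K ≃ₗᵢ[ℂ] K)) (x : H) (y : K) :
    braiding hω U V (x ⊗ₜ[ℂ] y : H ⊗[ℂ] K) =
      (∑ m : ZMod N, V (.ofAdd m) y ⊗ₜ[ℂ] degreeProj ω U m x : K ⊗[ℂ] H) := by
  rw [braiding, complIso_coe, LinearIsometryEquiv.trans_apply, twist_tmul, map_sum]
  simp

/-- The defining formula of the braiding, on vectors that are homogeneous of degrees `m` and `n`:
`ξ ⊗ η ↦ ω ^ (m n) η ⊗ ξ`. -/
theorem braiding_homogeneous (hω : IsPrimitiveRoot ω N)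
    (U : Multiplicative (ZMod N) →* (H ≃ₗᵢ[ℂ] H)) (V : Multiplicative (ZMod N) →* (K ≃ₗᵢ[ℂ] K))
    (m n : ZMod N) (x : H) (y : K) (hx : ∀ t, U (.ofAdd t) x = chi ω (t * m) • x)
    (hy : ∀ t, V (.ofAdd t) y = chi ω (t * n) • y) :
    braiding hω U V (x ⊗ₜ[ℂ] y : H ⊗[ℂ] K) =
      chi ω (m * n) • ((y ⊗ₜ[ℂ] x : K ⊗[ℂ] H) : HTensor K H) := by
  rw [braiding_tmul]
  simp only [degreeProj_of_degree hω U m _ x hx, hy, TensorProduct.tmul_ite]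
  rw [Finset.sum_ite_eq, if_pos (Finset.mem_univ _), ← TensorProduct.smul_tmul',
    Completion.coe_smul]

end Braiding

/-! ### Braided tensor products -/

section BraidedTensor

universe u v u' v'

/-- A covariant representation of a `ℤ/N`-`C*`-algebra on a Hilbert space: a unitary
representation `U` of `ℤ/N` and an equivariant unital representation of `X`. -/
structure CovRep {N : ℕ} [NeZero N] {X : Type u} [CStarAlgebra X] (ρ : Coaction N X) :
    Type (u + 1) where
  H : Type u
  [instNorm : NormedAddCommGroup H]
  [instInner : InnerProductSpace ℂ H]
  [instComplete : CompleteSpace H]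
  [instNontrivial : Nontrivial H]
  U : Multiplicative (ZMod N) →* (H ≃ₗᵢ[ℂ] H)
  rep : X →⋆ₐ[ℂ] (H →L[ℂ] H)
  covariant : ∀ (t : ZMod N) (x : X) (ξ : H),
    U (.ofAdd t) (rep x ξ) = rep (ρ.hom x t) (U (.ofAdd t) ξ)

attribute [instance] CovRep.instNorm CovRep.instInner CovRep.instComplete CovRep.instNontrivial

/-- The pull-back of a covariant representation along an equivariant morphism. -/
abbrev CovRep.comap {N : ℕ} [NeZero N] {X Y : Type u} [CStarAlgebra X] [CStarAlgebra Y]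
    {ρX : Coaction N X} {ρY : Coaction N Y} (φ : EquivariantHom ρX ρY) (i : CovRep ρY) :
    CovRep ρX where
  H := i.H
  U := i.U
  rep := i.rep.comp φ.toStarAlgHom
  covariant t x ξ := by
    have h := i.covariant t (φ.toStarAlgHom x) ξ
    rw [φ.equivariant] at h
    exact h

/-- The `C*`-algebra of bounded families in a product of `C*`-algebras. -/
def CStarProd {I : Type*} (B : I → Type*) [∀ i, CStarAlgebra (B i)] [∀ i, NormOneClass (B i)] :
    Type _ := lp B ⊤

namespace CStarProd

variable {I : Type*} {B : I → Type*} [∀ i, CStarAlgebra (B i)] [∀ i, NormOneClass (B i)]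

/-- The `C*`-algebra structure on the algebra of bounded families. -/
abbrev cstarLp : CStarAlgebra (lp B ⊤) where

instance : CStarAlgebra (CStarProd B) := cstarLp

/-- A family of `*`-homomorphisms defines a `*`-homomorphism into the product. -/
def pi {A : Type*} [CStarAlgebra A] (f : ∀ i, A →⋆ₐ[ℂ] B i) : A →⋆ₐ[ℂ] CStarProd B where
  toFun a := (⟨fun i => f i a, memℓp_infty ⟨‖a‖, by
    rintro _ ⟨i, rfl⟩
    exact NonUnitalStarAlgHom.norm_apply_le (f i) a⟩⟩ : lp B ⊤)
  map_one' := lp.ext (funext fun i => map_one (f i))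
  map_mul' a b := lp.ext (funext fun i => map_mul (f i) a b)
  map_zero' := lp.ext (funext fun i => map_zero (f i))
  map_add' a b := lp.ext (funext fun i => map_add (f i) a b)
  commutes' c := lp.ext (funext fun i => AlgHomClass.commutes (f i) c)
  map_star' a := lp.ext (funext fun i => map_star (f i) a)

/-- The projection onto a factor of the product. -/
def eval (i : I) : CStarProd B →⋆ₐ[ℂ] B i where
  toFun a := (show lp B ⊤ from a) i
  map_one' := rfl
  map_mul' _ _ := rfl
  map_zero' := rfl
  map_add' _ _ := rfl
  commutes' _ := rfl
  map_star' _ := rfl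

theorem ext {a b : CStarProd B} (h : ∀ i, eval i a = eval i b) : a = b :=
  lp.ext (E := B) (funext h)

@[simp]
theorem eval_pi {A : Type*} [CStarAlgebra A] (f : ∀ i, A →⋆ₐ[ℂ] B i) (i : I) (a : A) :
    eval i (pi f a) = f i a := rfl

end CStarProd

/-- The `C*`-subalgebra generated by a set. -/
def generatedCStar {A : Type*} [CStarAlgebra A] (s : Set A) : StarSubalgebra ℂ A :=
  (StarAlgebra.adjoin ℂ s).topologicalClosure

theorem isClosed_generatedCStar {A : Type*} [CStarAlgebra A] (s : Set A) :
    IsClosed (generatedCStar s : Set A) := StarSubalgebra.isClosed_topologicalClosure _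

theorem subset_generatedCStar {A : Type*} [CStarAlgebra A] (s : Set A) {a : A} (ha : a ∈ s) :
    a ∈ generatedCStar s :=
  StarSubalgebra.le_topologicalClosure _ (StarAlgebra.subset_adjoin ℂ s ha)

/-- A `*`-homomorphism maps the `C*`-subalgebra generated by `s` into that generated by `t` if it
maps `s` to `t`. -/
theorem map_generatedCStar {A B : Type*} [CStarAlgebra A] [CStarAlgebra B] (f : A →⋆ₐ[ℂ] B)
    {s : Set A} {t : Set B} (h : ∀ a ∈ s, f a ∈ t) {a : A} (ha : a ∈ generatedCStar s) :
    f a ∈ generatedCStar t := by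
  have h₁ : StarAlgebra.adjoin ℂ s ≤ (generatedCStar t).comap f :=
    StarAlgebra.adjoin_le fun a ha => subset_generatedCStar t (h a ha)
  exact StarSubalgebra.topologicalClosure_minimal h₁
    ((isClosed_generatedCStar t).preimage (continuous_starAlgHom f)) ha

/-- Two `*`-homomorphisms agree on the `C*`-subalgebra generated by `s` if they agree on `s`. -/
theorem eqOn_generatedCStar {A B : Type*} [CStarAlgebra A] [CStarAlgebra B] (f g : A →⋆ₐ[ℂ] B)
    {s : Set A} (h : ∀ a ∈ s, f a = g a) {a : A} (ha : a ∈ generatedCStar s) : f a = g a := by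
  have h₁ : StarAlgebra.adjoin ℂ s ≤ StarAlgHom.equalizer f g := StarAlgebra.adjoin_le h
  exact StarSubalgebra.topologicalClosure_minimal h₁
    (isClosed_eq (continuous_starAlgHom f) (continuous_starAlgHom g)) ha

/-- The `C*`-subalgebra generated by a set, as a `C*`-algebra. -/
def GeneratedCStar {A : Type*} [CStarAlgebra A] (s : Set A) : Type _ := generatedCStar s

namespace GeneratedCStar

variable {A B C : Type*} [CStarAlgebra A] [CStarAlgebra B] [CStarAlgebra C]

instance (s : Set A) : CStarAlgebra (GeneratedCStar s) :=
  StarSubalgebra.cstarAlgebra (generatedCStar s) (h_closed := isClosed_generatedCStar s)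

/-- The inclusion. -/
def incl (s : Set A) : GeneratedCStar s →⋆ₐ[ℂ] A := (generatedCStar s).subtype

theorem incl_injective (s : Set A) : Function.Injective (incl s) := Subtype.val_injective

theorem incl_mem (s : Set A) (a : GeneratedCStar s) : incl s a ∈ generatedCStar s := a.2

/-- Restriction of the codomain of a `*`-homomorphism. -/
def codRestrict (s : Set A) (f : C →⋆ₐ[ℂ] A) (hf : ∀ c, f c ∈ generatedCStar s) :
    C →⋆ₐ[ℂ] GeneratedCStar s := StarAlgHom.codRestrict f (generatedCStar s) hf

@[simp]
theorem incl_codRestrict (s : Set A) (f : C →⋆ₐ[ℂ] A) (hf : ∀ c, f c ∈ generatedCStar s) (c : C) :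
    incl s (codRestrict s f hf c) = f c := rfl

/-- The restriction of a `*`-homomorphism to generated `C*`-subalgebras. -/
def map (s : Set A) (t : Set B) (f : A →⋆ₐ[ℂ] B) (h : ∀ a ∈ s, f a ∈ t) :
    GeneratedCStar s →⋆ₐ[ℂ] GeneratedCStar t :=
  codRestrict t (f.comp (incl s)) fun a => map_generatedCStar f h (incl_mem s a)

@[simp]
theorem incl_map (s : Set A) (t : Set B) (f : A →⋆ₐ[ℂ] B) (h : ∀ a ∈ s, f a ∈ t)
    (a : GeneratedCStar s) : incl t (map s t f h a) = f (incl s a) := rfl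

end GeneratedCStar

/-- Conjugation with a unitary, as a `*`-homomorphism `T ↦ e T e⁻¹`. -/
def conjHom {E F : Type*} [NormedAddCommGroup E] [InnerProductSpace ℂ E] [CompleteSpace E]
    [NormedAddCommGroup F] [InnerProductSpace ℂ F] [CompleteSpace F] (e : E ≃ₗᵢ[ℂ] F) :
    (E →L[ℂ] E) →⋆ₐ[ℂ] (F →L[ℂ] F) where
  toFun := e.conjStarAlgEquiv
  map_one' := map_one _
  map_mul' := map_mul _
  map_zero' := map_zero _
  map_add' := map_add _
  commutes' c := by
    ext x
    simp [Algebra.algebraMap_eq_smul_one]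
  map_star' := map_star _

theorem conjHom_apply {E F : Type*} [NormedAddCommGroup E] [InnerProductSpace ℂ E]
    [CompleteSpace E] [NormedAddCommGroup F] [InnerProductSpace ℂ F] [CompleteSpace F]
    (e : E ≃ₗᵢ[ℂ] F) (T : E →L[ℂ] E) (x : F) : conjHom e T x = e (T (e.symm x)) := rfl

variable {N : ℕ} [NeZero N] {ω : ℂ} (hω : IsPrimitiveRoot ω N)
variable {X : Type u} {Y : Type v} [CStarAlgebra X] [CStarAlgebra Y]

/-- The operators on the Hilbert space `L^X ⊗ L^Y`, for a pair of covariant representations. -/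
abbrev PairOp {ρX : Coaction N X} {ρY : Coaction N Y} (i : CovRep ρX × CovRep ρY) : Type _ :=
  HTensor i.1.H i.2.H →L[ℂ] HTensor i.1.H i.2.H

/-- The `C*`-algebra of bounded families of operators on the Hilbert spaces `L^X ⊗ L^Y`, over all
pairs of covariant representations of `X` on `L^X` and of `Y` on `L^Y`. -/
def BraidedAmbient (ρX : Coaction N X) (ρY : Coaction N Y) : Type _ :=
  CStarProd (PairOp (ρX := ρX) (ρY := ρY))

instance (ρX : Coaction N X) (ρY : Coaction N Y) : CStarAlgebra (BraidedAmbient ρX ρY) :=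
  inferInstanceAs (CStarAlgebra (CStarProd (PairOp (ρX := ρX) (ρY := ρY))))

/-- The representation `x ↦ x ⊗ 1` of `X` on `L^X ⊗ L^Y`. -/
def j₁Rep {ρX : Coaction N X} {ρY : Coaction N Y} (i : CovRep ρX × CovRep ρY) :
    X →⋆ₐ[ℂ] PairOp i :=
  (ampl i.2.H).comp i.1.rep

/-- The representation `y ↦ c⁻¹ (y ⊗ 1) c` of `Y` on `L^X ⊗ L^Y`, for the braiding unitary
`c : L^X ⊗ L^Y → L^Y ⊗ L^X`. -/
def j₂Rep {ρX : Coaction N X} {ρY : Coaction N Y} (i : CovRep ρX × CovRep ρY) :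
    Y →⋆ₐ[ℂ] PairOp i :=
  (conjHom (braiding hω i.1.U i.2.U).symm).comp ((ampl i.1.H).comp i.2.rep)

/-- The map `j₁` with values in the families of operators. -/
def j₁Amb (ρX : Coaction N X) (ρY : Coaction N Y) : X →⋆ₐ[ℂ] BraidedAmbient ρX ρY :=
  CStarProd.pi (B := PairOp (ρX := ρX) (ρY := ρY)) j₁Rep

/-- The map `j₂` with values in the families of operators. -/
def j₂Amb (ρX : Coaction N X) (ρY : Coaction N Y) : Y →⋆ₐ[ℂ] BraidedAmbient ρX ρY :=
  CStarProd.pi (B := PairOp (ρX := ρX) (ρY := ρY)) (j₂Rep hω)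

/-- The set of the elements `j₁(x) j₂(y)`. -/
def braidedProducts (ρX : Coaction N X) (ρY : Coaction N Y) : Set (BraidedAmbient ρX ρY) :=
  {a | ∃ (x : X) (y : Y), a = j₁Amb ρX ρY x * j₂Amb hω ρX ρY y}

/-- The braided tensor product `X ⊠ Y`, the `C*`-algebra that is generated by the elements
`j₁(x) j₂(y)` with `j₁(x) = x ⊗ 1` and `j₂(y) = c⁻¹ (y ⊗ 1) c`.  For every pair of covariant
representations of `X` on `L^X` and of `Y` on `L^Y` it is represented on `L^X ⊗ L^Y`, and its norm
is the supremum of the norms in these representations.  The representation given by a pair of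
faithful covariant representations is isometric, so this is the `C*`-subalgebra of
`B(L^X ⊗ L^Y)` generated by the `j₁(x) j₂(y)` for any such pair. -/
def BraidedTensor (ρX : Coaction N X) (ρY : Coaction N Y) : Type _ :=
  GeneratedCStar (braidedProducts hω ρX ρY)

instance (ρX : Coaction N X) (ρY : Coaction N Y) : CStarAlgebra (BraidedTensor hω ρX ρY) :=
  inferInstanceAs (CStarAlgebra (GeneratedCStar (braidedProducts hω ρX ρY)))

namespace BraidedTensor

section

variable (ρX : Coaction N X) (ρY : Coaction N Y)

/-- The embedding of the first factor. -/
def j₁ : X →⋆ₐ[ℂ] BraidedTensor hω ρX ρY :=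
  GeneratedCStar.codRestrict (braidedProducts hω ρX ρY) (j₁Amb ρX ρY) fun x =>
    subset_generatedCStar _ ⟨x, 1, by rw [map_one, mul_one]⟩

/-- The embedding of the second factor. -/
def j₂ : Y →⋆ₐ[ℂ] BraidedTensor hω ρX ρY :=
  GeneratedCStar.codRestrict (braidedProducts hω ρX ρY) (j₂Amb hω ρX ρY) fun y =>
    subset_generatedCStar _ ⟨1, y, by rw [map_one, one_mul]⟩

/-- The representation of `X ⊠ Y` on `L^X ⊗ L^Y`. -/
def toRep (i : CovRep ρX × CovRep ρY) : BraidedTensor hω ρX ρY →⋆ₐ[ℂ] PairOp i :=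
  (CStarProd.eval (B := PairOp (ρX := ρX) (ρY := ρY)) i).comp
    (GeneratedCStar.incl (braidedProducts hω ρX ρY))

@[simp]
theorem toRep_j₁ (i : CovRep ρX × CovRep ρY) (x : X) :
    toRep hω ρX ρY i (j₁ hω ρX ρY x) = j₁Rep i x := rfl

@[simp]
theorem toRep_j₂ (i : CovRep ρX × CovRep ρY) (y : Y) :
    toRep hω ρX ρY i (j₂ hω ρX ρY y) = j₂Rep hω i y := rfl

end

variable {ρX : Coaction N X} {ρY : Coaction N Y}

theorem ext_rep {a b : BraidedTensor hω ρX ρY}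
    (h : ∀ i, toRep hω ρX ρY i a = toRep hω ρX ρY i b) : a = b :=
  GeneratedCStar.incl_injective (braidedProducts hω ρX ρY)
    (CStarProd.ext (B := PairOp (ρX := ρX) (ρY := ρY)) h)

theorem j₂Rep_tmul (i : CovRep ρX × CovRep ρY) {e : ZMod N} {y : Y}
    (hy : IsHomogeneous ω ρY e y) (ξ : i.1.H) (η : i.2.H) :
    j₂Rep hω i y (ξ ⊗ₜ[ℂ] η : i.1.H ⊗[ℂ] i.2.H) =
      (i.1.U (.ofAdd (-e)) ξ ⊗ₜ[ℂ] i.2.rep y η : i.1.H ⊗[ℂ] i.2.H) := by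
  change (braiding hω i.1.U i.2.U).symm (ampl i.1.H (i.2.rep y)
    ((braiding hω i.1.U i.2.U).symm.symm (ξ ⊗ₜ[ℂ] η : i.1.H ⊗[ℂ] i.2.H))) = _
  rw [LinearIsometryEquiv.symm_symm, LinearIsometryEquiv.symm_apply_eq, braiding_tmul,
    braiding_tmul]
  have h : ∀ z : i.2.H ⊗[ℂ] i.1.H, ampl i.1.H (i.2.rep y) (z : HTensor i.2.H i.1.H) =
      ((i.2.rep y).rTensor i.1.H z : i.2.H ⊗[ℂ] i.1.H) := fun z =>
    ContinuousLinearMap.completion_apply_coe _ z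
  rw [h, map_sum]
  congr 1
  refine Finset.sum_congr rfl fun m _ => ?_
  rw [ContinuousLinearMap.rTensor_tmul, i.2.covariant, hy, map_smul,
    degreeProj_unitary hω, smul_apply, TensorProduct.smul_tmul, smul_smul,
    ← chi_add hω]
  have h0 : m * e + -e * m = 0 := by ring
  rw [h0, chi_zero, one_smul]

/-- The commutation relation between the two factors, for homogeneous elements. -/
theorem j₁_mul_j₂ {d e : ZMod N} {x : X} {y : Y} (hx : IsHomogeneous ω ρX d x)
    (hy : IsHomogeneous ω ρY e y) :
    j₁ hω ρX ρY x * j₂ hω ρX ρY y = chi ω (d * e) • (j₂ hω ρX ρY y * j₁ hω ρX ρY x) := by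
  refine ext_rep hω fun i => ?_
  rw [map_smul, map_mul, map_mul, toRep_j₁, toRep_j₂]
  refine HTensor.ext fun ξ η => ?_
  rw [mul_apply_eq_comp, smul_apply,
    mul_apply_eq_comp, j₂Rep_tmul hω i hy]
  change ampl i.2.H (i.1.rep x) _ = chi ω (d * e) • j₂Rep hω i y (ampl i.2.H (i.1.rep x) _)
  rw [ampl_tmul, ampl_tmul, j₂Rep_tmul hω i hy, i.1.covariant, hx, map_smul,
    smul_apply, ← TensorProduct.smul_tmul', Completion.coe_smul, smul_smul,
    ← chi_add hω]
  have h0 : d * e + -e * d = 0 := by ring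
  rw [h0, chi_zero, one_smul]

section map

variable {X' : Type u} {Y' : Type v} [CStarAlgebra X'] [CStarAlgebra Y']
  {ρX' : Coaction N X'} {ρY' : Coaction N Y'}

/-- Restriction of a family to the pull-backs of the covariant representations along `φ` and `ψ`. -/
def ambientMap (φ : EquivariantHom ρX ρX') (ψ : EquivariantHom ρY ρY') :
    BraidedAmbient ρX ρY →⋆ₐ[ℂ] BraidedAmbient ρX' ρY' :=
  CStarProd.pi (B := PairOp (ρX := ρX') (ρY := ρY')) fun i =>
    CStarProd.eval (B := PairOp (ρX := ρX) (ρY := ρY)) (i.1.comap φ, i.2.comap ψ)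

theorem ambientMap_j₁ (φ : EquivariantHom ρX ρX') (ψ : EquivariantHom ρY ρY') (x : X) :
    ambientMap φ ψ (j₁Amb ρX ρY x) = j₁Amb ρX' ρY' (φ x) := rfl

theorem ambientMap_j₂ (φ : EquivariantHom ρX ρX') (ψ : EquivariantHom ρY ρY') (y : Y) :
    ambientMap φ ψ (j₂Amb hω ρX ρY y) = j₂Amb hω ρX' ρY' (ψ y) := rfl

/-- The morphism `φ ⊠ ψ`, with `(φ ⊠ ψ)(j₁(x) j₂(y)) = j₁(φ(x)) j₂(ψ(y))`. -/
def map (φ : EquivariantHom ρX ρX') (ψ : EquivariantHom ρY ρY') :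
    BraidedTensor hω ρX ρY →⋆ₐ[ℂ] BraidedTensor hω ρX' ρY' :=
  GeneratedCStar.map (braidedProducts hω ρX ρY) (braidedProducts hω ρX' ρY') (ambientMap φ ψ) (by
    rintro _ ⟨x, y, rfl⟩
    exact ⟨φ x, ψ y, by rw [map_mul, ambientMap_j₁, ambientMap_j₂]⟩)

@[simp]
theorem map_j₁ (φ : EquivariantHom ρX ρX') (ψ : EquivariantHom ρY ρY') (x : X) :
    map hω φ ψ (j₁ hω ρX ρY x) = j₁ hω ρX' ρY' (φ x) := rfl

@[simp]
theorem map_j₂ (φ : EquivariantHom ρX ρX') (ψ : EquivariantHom ρY ρY') (y : Y) :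
    map hω φ ψ (j₂ hω ρX ρY y) = j₂ hω ρX' ρY' (ψ y) := rfl

end map

end BraidedTensor

end BraidedTensor

/-! ### Anyonic permutation matrices and anyonic unitary matrices -/

section Relations

variable {N : ℕ} [NeZero N] {B C : Type*} [Ring B] [StarRing B] [Algebra ℂ B] [Ring C]
  [StarRing C] [Algebra ℂ C]

/-- The relators of the anyonic quantum permutation group: the differences of both sides of the
relations `q₀ᵢ = δᵢ₀`, `qᵢ₀ = δᵢ₀`, `qᵢⱼ* = ω ^ (-i (i - j)) q₋ᵢ,₋ⱼ`,
`qₖ,ᵢ₊ⱼ = ∑ₗ ω ^ (-l (i - k + l)) qₖ₋ₗ,ᵢ qₗⱼ` and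
`qᵢ₊ⱼ,ₖ = ∑ₗ ω ^ (-i (l - j)) qⱼₗ qᵢ,ₖ₋ₗ`. -/
def permRelators (ω : ℂ) (q : Matrix (ZMod N) (ZMod N) B) : Set B :=
  {r | (∃ i, r = q 0 i - if i = 0 then 1 else 0) ∨
    (∃ i, r = q i 0 - if i = 0 then 1 else 0) ∨
    (∃ i j, r = star (q i j) - chi ω (-(i * (i - j))) • q (-i) (-j)) ∨
    (∃ i j k, r = q k (i + j) -
      ∑ l, chi ω (-(l * (i - k + l))) • (q (k - l) i * q l j)) ∨
    (∃ i j k, r = q (i + j) k - ∑ l, chi ω (-(i * (l - j))) • (q j l * q i (k - l)))}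

/-- The matrix `(ω ^ (-i (j - i)) uᵢⱼ*)`. -/
def twistConj (ω : ℂ) (u : Matrix (ZMod N) (ZMod N) B) : Matrix (ZMod N) (ZMod N) B :=
  Matrix.of fun i j => chi ω (-(i * (j - i))) • star (u i j)

theorem twistConj_apply (ω : ℂ) (u : Matrix (ZMod N) (ZMod N) B) (i j : ZMod N) :
    twistConj ω u i j = chi ω (-(i * (j - i))) • star (u i j) := rfl

/-- The relators of the anyonic free unitary quantum group: the entries of `u* u - 1` and
`u u* - 1`, and the same for `twistConj ω u` instead of `u`. -/
def unitaryRelators (ω : ℂ) (u : Matrix (ZMod N) (ZMod N) B) : Set B :=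
  {r | ∃ i j, r = (star u * u - 1) i j ∨ r = (u * star u - 1) i j ∨
    r = (star (twistConj ω u) * twistConj ω u - 1) i j ∨
    r = (twistConj ω u * star (twistConj ω u) - 1) i j}

/-- The matrices that satisfy the relations of the anyonic quantum permutation group. -/
structure IsAnyonicPerm (ω : ℂ) (q : Matrix (ZMod N) (ZMod N) B) : Prop where
  zero_left : ∀ i, q 0 i = if i = 0 then 1 else 0
  zero_right : ∀ i, q i 0 = if i = 0 then 1 else 0
  star_eq : ∀ i j, star (q i j) = chi ω (-(i * (i - j))) • q (-i) (-j)
  right_add : ∀ i j k, q k (i + j) = ∑ l, chi ω (-(l * (i - k + l))) • (q (k - l) i * q l j)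
  left_add : ∀ i j k, q (i + j) k = ∑ l, chi ω (-(i * (l - j))) • (q j l * q i (k - l))

/-- The matrices that satisfy the relations of the anyonic free unitary quantum group. -/
structure IsAnyonicUnitary (ω : ℂ) (u : Matrix (ZMod N) (ZMod N) B) : Prop where
  unitary : u ∈ unitary (Matrix (ZMod N) (ZMod N) B)
  unitary_twist : twistConj ω u ∈ _root_.unitary (Matrix (ZMod N) (ZMod N) B)

theorem permRelators_eq_zero {ω : ℂ} {q : Matrix (ZMod N) (ZMod N) B} :
    (∀ r ∈ permRelators ω q, r = 0) ↔ IsAnyonicPerm ω q := by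
  constructor
  · intro h
    refine ⟨fun i => sub_eq_zero.mp (h _ ?_), fun i => sub_eq_zero.mp (h _ ?_),
      fun i j => sub_eq_zero.mp (h _ ?_), fun i j k => sub_eq_zero.mp (h _ ?_),
      fun i j k => sub_eq_zero.mp (h _ ?_)⟩
    · exact .inl ⟨i, rfl⟩
    · exact .inr (.inl ⟨i, rfl⟩)
    · exact .inr (.inr (.inl ⟨i, j, rfl⟩))
    · exact .inr (.inr (.inr (.inl ⟨i, j, k, rfl⟩)))
    · exact .inr (.inr (.inr (.inr ⟨i, j, k, rfl⟩)))
  · rintro h r (⟨i, rfl⟩ | ⟨i, rfl⟩ | ⟨i, j, rfl⟩ | ⟨i, j, k, rfl⟩ | ⟨i, j, k, rfl⟩) <;>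
      rw [sub_eq_zero]
    exacts [h.zero_left i, h.zero_right i, h.star_eq i j, h.right_add i j k, h.left_add i j k]

theorem unitaryRelators_eq_zero {ω : ℂ} {u : Matrix (ZMod N) (ZMod N) B} :
    (∀ r ∈ unitaryRelators ω u, r = 0) ↔ IsAnyonicUnitary ω u := by
  constructor
  · intro h
    refine ⟨Unitary.mem_iff.mpr ⟨?_, ?_⟩, Unitary.mem_iff.mpr ⟨?_, ?_⟩⟩ <;>
      refine sub_eq_zero.mp (Matrix.ext fun i j => h _ ⟨i, j, ?_⟩)
    exacts [.inl rfl, .inr (.inl rfl), .inr (.inr (.inl rfl)), .inr (.inr (.inr rfl))]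
  · rintro h r ⟨i, j, rfl | rfl | rfl | rfl⟩
    · rw [Unitary.star_mul_self_of_mem h.unitary, sub_self]; rfl
    · rw [Unitary.mul_star_self_of_mem h.unitary, sub_self]; rfl
    · rw [Unitary.star_mul_self_of_mem h.unitary_twist, sub_self]; rfl
    · rw [Unitary.mul_star_self_of_mem h.unitary_twist, sub_self]; rfl

theorem map_permRelators (f : B →⋆ₐ[ℂ] C) {ω : ℂ} {q : Matrix (ZMod N) (ZMod N) B} :
    (∀ r ∈ permRelators ω q, f r = 0) ↔ IsAnyonicPerm ω (q.map f) := by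
  rw [← permRelators_eq_zero]
  constructor
  · rintro h r (⟨i, rfl⟩ | ⟨i, rfl⟩ | ⟨i, j, rfl⟩ | ⟨i, j, k, rfl⟩ | ⟨i, j, k, rfl⟩)
    · simpa [apply_ite f] using h _ (.inl ⟨i, rfl⟩)
    · simpa [apply_ite f] using h _ (.inr (.inl ⟨i, rfl⟩))
    · simpa [map_star] using h _ (.inr (.inr (.inl ⟨i, j, rfl⟩)))
    · simpa using h _ (.inr (.inr (.inr (.inl ⟨i, j, k, rfl⟩))))
    · simpa using h _ (.inr (.inr (.inr (.inr ⟨i, j, k, rfl⟩))))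
  · rintro h r (⟨i, rfl⟩ | ⟨i, rfl⟩ | ⟨i, j, rfl⟩ | ⟨i, j, k, rfl⟩ | ⟨i, j, k, rfl⟩)
    · simpa [apply_ite f] using h _ (.inl ⟨i, rfl⟩)
    · simpa [apply_ite f] using h _ (.inr (.inl ⟨i, rfl⟩))
    · simpa [map_star] using h _ (.inr (.inr (.inl ⟨i, j, rfl⟩)))
    · simpa using h _ (.inr (.inr (.inr (.inl ⟨i, j, k, rfl⟩))))
    · simpa using h _ (.inr (.inr (.inr (.inr ⟨i, j, k, rfl⟩))))

theorem star_map (f : B →⋆ₐ[ℂ] C) (u : Matrix (ZMod N) (ZMod N) B) :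
    star (u.map f) = (star u).map f := Matrix.ext fun i j => (map_star f (u j i)).symm

theorem twistConj_map (f : B →⋆ₐ[ℂ] C) (ω : ℂ) (u : Matrix (ZMod N) (ZMod N) B) :
    twistConj ω (u.map f) = (twistConj ω u).map f := Matrix.ext fun i j => by
  simp [twistConj_apply, map_star]

theorem map_unitaryRelators (f : B →⋆ₐ[ℂ] C) {ω : ℂ} {u : Matrix (ZMod N) (ZMod N) B} :
    (∀ r ∈ unitaryRelators ω u, f r = 0) ↔ IsAnyonicUnitary ω (u.map f) := by
  rw [← unitaryRelators_eq_zero]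
  have key : ∀ a b : Matrix (ZMod N) (ZMod N) B, ∀ i j,
      (a.map f * b.map f - 1) i j = f ((a * b - 1) i j) := fun a b i j => by
    rw [Matrix.sub_apply, Matrix.sub_apply, map_sub]
    congr 1
    · simp [Matrix.mul_apply]
    · simp [Matrix.one_apply, apply_ite f]
  constructor
  · rintro h r ⟨i, j, hr⟩
    rw [twistConj_map, star_map, star_map, key, key, key, key] at hr
    rcases hr with rfl | rfl | rfl | rfl <;> refine h _ ⟨i, j, ?_⟩ <;> tauto
  · rintro h r ⟨i, j, hr⟩
    refine h _ ⟨i, j, ?_⟩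
    rw [twistConj_map, star_map, star_map, key, key, key, key]
    rcases hr with rfl | rfl | rfl | rfl <;> tauto

theorem map_mem_unitary (f : B →⋆ₐ[ℂ] C) {u : Matrix (ZMod N) (ZMod N) B}
    (h : u ∈ unitary (Matrix (ZMod N) (ZMod N) B)) :
    u.map f ∈ unitary (Matrix (ZMod N) (ZMod N) C) := by
  have h1 : (1 : Matrix (ZMod N) (ZMod N) B).map f = 1 :=
    Matrix.map_one f (map_zero f) (map_one f)
  refine Unitary.mem_iff.mpr ⟨?_, ?_⟩
  · rw [star_map, ← Matrix.map_mul, Unitary.star_mul_self_of_mem h, h1]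
  · rw [star_map, ← Matrix.map_mul, Unitary.mul_star_self_of_mem h, h1]

theorem IsAnyonicPerm.map (f : B →⋆ₐ[ℂ] C) {ω : ℂ} {q : Matrix (ZMod N) (ZMod N) B}
    (h : IsAnyonicPerm ω q) : IsAnyonicPerm ω (q.map f) :=
  (map_permRelators f).mp fun r hr => by rw [permRelators_eq_zero.mpr h r hr, map_zero]

theorem IsAnyonicUnitary.map (f : B →⋆ₐ[ℂ] C) {ω : ℂ} {u : Matrix (ZMod N) (ZMod N) B}
    (h : IsAnyonicUnitary ω u) : IsAnyonicUnitary ω (u.map f) :=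
  (map_unitaryRelators f).mp fun r hr => by rw [unitaryRelators_eq_zero.mpr h r hr, map_zero]

section twist

variable {ω : ℂ}

/-- The relations of the anyonic quantum permutation group are homogeneous. -/
theorem IsAnyonicPerm.smul (hω : IsPrimitiveRoot ω N)
    [StarModule ℂ B] {q : Matrix (ZMod N) (ZMod N) B}
    (h : IsAnyonicPerm ω q) (t : ZMod N) :
    IsAnyonicPerm ω (Matrix.of fun i j => chi ω (t * (j - i)) • q i j) := by
  refine ⟨fun i => ?_, fun i => ?_, fun i j => ?_, fun i j k => ?_, fun i j k => ?_⟩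
  · rw [Matrix.of_apply, h.zero_left]
    split_ifs with hi
    · rw [hi, sub_zero, mul_zero, chi_zero, one_smul]
    · rw [smul_zero]
  · rw [Matrix.of_apply, h.zero_right]
    split_ifs with hi
    · rw [hi, sub_zero, mul_zero, chi_zero, one_smul]
    · rw [smul_zero]
  · rw [Matrix.of_apply, Matrix.of_apply, star_smul, h.star_eq, chi_star hω, smul_smul, smul_smul,
      ← chi_add hω, ← chi_add hω]
    congr 2; ring
  · rw [Matrix.of_apply, h.right_add, Finset.smul_sum]
    refine Finset.sum_congr rfl fun l _ => ?_
    rw [Matrix.of_apply, Matrix.of_apply, smul_mul_smul_comm, smul_smul, smul_smul, ← chi_add hω,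
      ← chi_add hω, ← chi_add hω]
    congr 2; ring
  · rw [Matrix.of_apply, h.left_add, Finset.smul_sum]
    refine Finset.sum_congr rfl fun l _ => ?_
    rw [Matrix.of_apply, Matrix.of_apply, smul_mul_smul_comm, smul_smul, smul_smul, ← chi_add hω,
      ← chi_add hω, ← chi_add hω]
    congr 2; ring

theorem smul_mem_unitary (hω : IsPrimitiveRoot ω N)
    [StarModule ℂ B] {u : Matrix (ZMod N) (ZMod N) B}
    (h : u ∈ unitary (Matrix (ZMod N) (ZMod N) B)) (t : ZMod N) :
    (Matrix.of fun i j => chi ω (t * (j - i)) • u i j) ∈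
      unitary (Matrix (ZMod N) (ZMod N) B) := by
  refine Unitary.mem_iff.mpr ⟨Matrix.ext fun i j => ?_, Matrix.ext fun i j => ?_⟩
  · have h₁ : star u * u = 1 := Unitary.star_mul_self_of_mem h
    have h' := congrFun (congrFun h₁ i) j
    rw [Matrix.mul_apply, Matrix.one_apply] at h' ⊢
    have h₂ : (if i = j then (1 : B) else 0) = chi ω (t * (j - i)) • if i = j then 1 else 0 := by
      split_ifs with hi
      · rw [hi, sub_self, mul_zero, chi_zero, one_smul]
      · rw [smul_zero]
    rw [h₂, ← h', Finset.smul_sum]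
    refine Finset.sum_congr rfl fun l _ => ?_
    rw [Matrix.star_apply, Matrix.star_apply, Matrix.of_apply, Matrix.of_apply, star_smul,
      smul_mul_smul_comm, chi_star hω, ← chi_add hω]
    congr 2; ring
  · have h₁ : u * star u = 1 := Unitary.mul_star_self_of_mem h
    have h' := congrFun (congrFun h₁ i) j
    rw [Matrix.mul_apply, Matrix.one_apply] at h' ⊢
    have h₂ : (if i = j then (1 : B) else 0) = chi ω (t * (j - i)) • if i = j then 1 else 0 := by
      split_ifs with hi
      · rw [hi, sub_self, mul_zero, chi_zero, one_smul]
      · rw [smul_zero]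
    rw [h₂, ← h', Finset.smul_sum]
    refine Finset.sum_congr rfl fun l _ => ?_
    rw [Matrix.star_apply, Matrix.star_apply, Matrix.of_apply, Matrix.of_apply, star_smul,
      smul_mul_smul_comm, chi_star hω, ← chi_add hω]
    congr 2; ring

/-- The relations of the anyonic free unitary quantum group are homogeneous. -/
theorem IsAnyonicUnitary.smul (hω : IsPrimitiveRoot ω N)
    [StarModule ℂ B] {u : Matrix (ZMod N) (ZMod N) B}
    (h : IsAnyonicUnitary ω u) (t : ZMod N) :
    IsAnyonicUnitary ω (Matrix.of fun i j => chi ω (t * (j - i)) • u i j) := by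
  refine ⟨smul_mem_unitary hω h.unitary t, ?_⟩
  have h' := smul_mem_unitary hω h.unitary_twist (-t)
  have h₂ : twistConj ω (Matrix.of fun i j => chi ω (t * (j - i)) • u i j) =
      Matrix.of fun i j => chi ω (-t * (j - i)) • twistConj ω u i j := by
    ext i j
    rw [twistConj_apply, Matrix.of_apply, Matrix.of_apply, twistConj_apply, star_smul,
      chi_star hω, smul_smul, smul_smul, ← chi_add hω, ← chi_add hω]
    congr 2; ring
  rwa [h₂]

/-- The product of two anyonic permutation matrices with braided commuting entries. -/
theorem IsAnyonicPerm.mul (hω : IsPrimitiveRoot ω N)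
    [StarModule ℂ B] {a b : Matrix (ZMod N) (ZMod N) B}
    (ha : IsAnyonicPerm ω a) (hb : IsAnyonicPerm ω b)
    (hab : ∀ i j k l, a i j * b k l = chi ω ((j - i) * (l - k)) • (b k l * a i j)) :
    IsAnyonicPerm ω (a * b) := by
  have hba : ∀ i j k l, b k l * a i j = chi ω (-((j - i) * (l - k))) • (a i j * b k l) :=
    fun i j k l => by rw [hab, smul_smul, chi_neg_mul_self hω, one_smul]
  refine ⟨fun i => ?_, fun i => ?_, fun i j => ?_, fun i j k => ?_, fun i j k => ?_⟩
  · simp [Matrix.mul_apply, ha.zero_left, hb.zero_left]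
  · simp [Matrix.mul_apply, ha.zero_right, hb.zero_right]
  · rw [Matrix.mul_apply, Matrix.mul_apply, star_sum, Finset.smul_sum,
      ← Equiv.sum_comp (Equiv.neg (ZMod N)) fun k => chi ω (-(i * (i - j))) •
        (a (-i) k * b k (-j))]
    refine Finset.sum_congr rfl fun k _ => ?_
    rw [star_mul, ha.star_eq, hb.star_eq, smul_mul_smul_comm, hba, smul_smul, ← chi_add hω,
      ← chi_add hω]
    rw [Equiv.neg_apply]
    congr 2; ring
  · have h₁ : ∀ l, chi ω (-(l * (i - k + l))) • ((a * b) (k - l) i * (a * b) l j) =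
        ∑ α, ∑ β, chi ω (-((i - α) * β)) •
          ((chi ω (-(l * (α - k + l))) • (a (k - l) α * a l β)) * (b α i * b β j)) := by
      intro l
      rw [Matrix.mul_apply, Matrix.mul_apply, Finset.sum_mul_sum, Finset.smul_sum]
      refine Finset.sum_congr rfl fun α _ => ?_
      rw [Finset.smul_sum]
      refine Finset.sum_congr rfl fun β _ => ?_
      have h₂ : a (k - l) α * b α i * (a l β * b β j) =
          a (k - l) α * (b α i * a l β) * b β j := by simp only [mul_assoc]
      rw [h₂, hba, mul_smul_comm, smul_mul_assoc, smul_mul_assoc, smul_smul, smul_smul,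
        ← chi_add hω, ← chi_add hω]
      congr 1
      · congr 1; ring
      · simp only [mul_assoc]
    simp only [h₁]
    rw [Finset.sum_comm]
    have h₃ : ∀ α, ∑ l, ∑ β, chi ω (-((i - α) * β)) •
          ((chi ω (-(l * (α - k + l))) • (a (k - l) α * a l β)) * (b α i * b β j)) =
        ∑ β, chi ω (-((i - α) * β)) • (a k (α + β) * (b α i * b β j)) := by
      intro α
      rw [Finset.sum_comm]
      refine Finset.sum_congr rfl fun β _ => ?_
      rw [← Finset.smul_sum, ← Finset.sum_mul, ← ha.right_add]
    simp only [h₃]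
    rw [Finset.sum_comm, Matrix.mul_apply]
    simp only [hb.right_add, Finset.mul_sum]
    rw [Finset.sum_comm]
    refine Finset.sum_congr rfl fun β _ => ?_
    rw [← Equiv.sum_comp (Equiv.addRight β)]
    refine Finset.sum_congr rfl fun α _ => ?_
    rw [Equiv.coe_addRight, add_sub_cancel_right, mul_smul_comm]
    congr 2; ring
  · have h₁ : ∀ l, chi ω (-(i * (l - j))) • ((a * b) j l * (a * b) i (k - l)) =
        ∑ α, ∑ β, chi ω (-(i * (α - j))) •
          ((a j α * a i β) * (chi ω (-(β * (l - α))) • (b α l * b β (k - l)))) := by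
      intro l
      rw [Matrix.mul_apply, Matrix.mul_apply, Finset.sum_mul_sum, Finset.smul_sum]
      refine Finset.sum_congr rfl fun α _ => ?_
      rw [Finset.smul_sum]
      refine Finset.sum_congr rfl fun β _ => ?_
      have h₂ : a j α * b α l * (a i β * b β (k - l)) =
          a j α * (b α l * a i β) * b β (k - l) := by simp only [mul_assoc]
      rw [h₂, hba, mul_smul_comm, smul_mul_assoc, mul_smul_comm, smul_smul, smul_smul,
        ← chi_add hω, ← chi_add hω]
      congr 1
      · congr 1; ring
      · simp only [mul_assoc]
    simp only [h₁]
    rw [Finset.sum_comm]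
    have h₃ : ∀ α, ∑ l, ∑ β, chi ω (-(i * (α - j))) •
          ((a j α * a i β) * (chi ω (-(β * (l - α))) • (b α l * b β (k - l)))) =
        ∑ β, chi ω (-(i * (α - j))) • ((a j α * a i β) * b (α + β) k) := by
      intro α
      rw [Finset.sum_comm]
      refine Finset.sum_congr rfl fun β _ => ?_
      rw [← Finset.smul_sum, ← Finset.mul_sum, ← hb.left_add, add_comm]
    simp only [h₃]
    rw [Matrix.mul_apply]
    simp only [ha.left_add, Finset.sum_mul]
    rw [Finset.sum_comm]
    refine Finset.sum_congr rfl fun α _ => ?_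
    rw [← Equiv.sum_comp (Equiv.addLeft α)]
    refine Finset.sum_congr rfl fun β _ => ?_
    rw [Equiv.coe_addLeft, add_sub_cancel_left, smul_mul_assoc]

/-- The product of two anyonic unitary matrices with braided commuting entries. -/
theorem IsAnyonicUnitary.mul (hω : IsPrimitiveRoot ω N)
    [StarModule ℂ B] {a b : Matrix (ZMod N) (ZMod N) B}
    (ha : IsAnyonicUnitary ω a) (hb : IsAnyonicUnitary ω b)
    (hab : ∀ i j k l, star (a i j) * star (b k l) =
      chi ω ((i - j) * (k - l)) • (star (b k l) * star (a i j))) :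
    IsAnyonicUnitary ω (a * b) := by
  refine ⟨mul_mem ha.unitary hb.unitary, ?_⟩
  have h : twistConj ω (a * b) = twistConj ω a * twistConj ω b := by
    ext i j
    rw [twistConj_apply, Matrix.mul_apply, Matrix.mul_apply, star_sum, Finset.smul_sum]
    refine Finset.sum_congr rfl fun k _ => ?_
    rw [twistConj_apply, twistConj_apply, smul_mul_smul_comm, hab, star_mul, smul_smul,
      ← chi_add hω, ← chi_add hω]
    congr 2; ring
  rw [h]
  exact mul_mem ha.unitary_twist hb.unitary_twist

theorem norm_le_one_of_isAnyonicUnitary {C : Type*} [CStarAlgebra C]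
    {u : Matrix (ZMod N) (ZMod N) C} (h : IsAnyonicUnitary ω u) (i j : ZMod N) : ‖u i j‖ ≤ 1 := by
  have h₁ : star u * u = 1 := Unitary.star_mul_self_of_mem h.unitary
  have h' := congrFun (congrFun h₁ j) j
  rw [Matrix.mul_apply, Matrix.one_apply_eq] at h'
  exact norm_le_one_of_sum_star_mul_self (fun k => u k j) h' i

theorem norm_le_one_of_isAnyonicPerm {C : Type*} [CStarAlgebra C]
    {q : Matrix (ZMod N) (ZMod N) C} (h : IsAnyonicPerm ω q) (i j : ZMod N) : ‖q i j‖ ≤ 1 := by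
  refine norm_le_one_of_sum_star_mul_self (fun k => q k j) ?_ i
  have h' := h.right_add (-j) j 0
  rw [neg_add_cancel, h.zero_left, if_pos rfl] at h'
  rw [h']
  refine Finset.sum_congr rfl fun k _ => ?_
  rw [h.star_eq, smul_mul_assoc, zero_sub]
  congr 2; ring

end twist

end Relations

/-! ### The anyonic quantum groups -/

section QuantumGroups

variable (N : ℕ) [NeZero N] (ω : ℂ)

/-- The matrix of the generators of the free `*`-algebra. -/
def freeMatrix : Matrix (ZMod N) (ZMod N) (FreeStarAlg (ZMod N × ZMod N)) :=
  Matrix.of fun i j => FreeStarAlg.gen (i, j)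

variable {N ω}

theorem freeMatrix_map {B : Type*} [Ring B] [StarRing B] [Algebra ℂ B] [StarModule ℂ B]
    (a : Matrix (ZMod N) (ZMod N) B) :
    (freeMatrix N).map (FreeStarAlg.lift fun g : ZMod N × ZMod N => a g.1 g.2) = a :=
  Matrix.ext fun i j => FreeStarAlg.lift_gen (fun g : ZMod N × ZMod N => a g.1 g.2) (i, j)

variable (N ω)

theorem isBounded_permRelators : IsBoundedPresentation (permRelators ω (freeMatrix N)) :=
  isBoundedPresentation_of_norm_le fun p hp g =>
    norm_le_one_of_isAnyonicPerm ((map_permRelators p.coeHom).mp hp) g.1 g.2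

theorem isBounded_unitaryRelators : IsBoundedPresentation (unitaryRelators ω (freeMatrix N)) :=
  isBoundedPresentation_of_norm_le fun p hp g =>
    norm_le_one_of_isAnyonicUnitary ((map_unitaryRelators p.coeHom).mp hp) g.1 g.2

/-- The `C*`-algebra `C(S_N⁺(R))` of the anyonic quantum permutation group. -/
def CSN : Type := UnivCStar (isBounded_permRelators N ω)

/-- The `C*`-algebra `C(U_N⁺(R))` of the anyonic free unitary quantum group. -/
def CUN : Type := UnivCStar (isBounded_unitaryRelators N ω)

instance : CStarAlgebra (CSN N ω) :=
  inferInstanceAs (CStarAlgebra (UnivCStar (isBounded_permRelators N ω)))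

instance : CStarAlgebra (CUN N ω) :=
  inferInstanceAs (CStarAlgebra (UnivCStar (isBounded_unitaryRelators N ω)))

/-- The matrix of the generators `qᵢⱼ` of `C(S_N⁺(R))`. -/
def qMat : Matrix (ZMod N) (ZMod N) (CSN N ω) :=
  Matrix.of fun i j => UnivCStar.gen (isBounded_permRelators N ω) (i, j)

/-- The matrix of the generators `uᵢⱼ` of `C(U_N⁺(R))`. -/
def uMat : Matrix (ZMod N) (ZMod N) (CUN N ω) :=
  Matrix.of fun i j => UnivCStar.gen (isBounded_unitaryRelators N ω) (i, j)

theorem isAnyonicPerm_qMat : IsAnyonicPerm ω (qMat N ω) :=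
  (map_permRelators (UnivCStar.mk (isBounded_permRelators N ω))).mp fun _ hr =>
    UnivCStar.mk_eq_zero _ hr

theorem isAnyonicUnitary_uMat : IsAnyonicUnitary ω (uMat N ω) :=
  (map_unitaryRelators (UnivCStar.mk (isBounded_unitaryRelators N ω))).mp fun _ hr =>
    UnivCStar.mk_eq_zero _ hr

variable {N ω}

section lift

variable {B : Type*} [CStarAlgebra B]

/-- The universal property of `C(S_N⁺(R))`. -/
def CSN.lift (a : Matrix (ZMod N) (ZMod N) B) (ha : IsAnyonicPerm ω a) : CSN N ω →⋆ₐ[ℂ] B :=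
  UnivCStar.lift (isBounded_permRelators N ω) (fun g => a g.1 g.2)
    ((map_permRelators _).mpr (by rwa [freeMatrix_map]))

@[simp]
theorem CSN.lift_qMat (a : Matrix (ZMod N) (ZMod N) B) (ha : IsAnyonicPerm ω a) (i j : ZMod N) :
    CSN.lift a ha (qMat N ω i j) = a i j :=
  UnivCStar.lift_gen (isBounded_permRelators N ω) (fun g => a g.1 g.2) _ (i, j)

theorem CSN.hom_ext {f g : CSN N ω →⋆ₐ[ℂ] B} (h : ∀ i j, f (qMat N ω i j) = g (qMat N ω i j)) :
    f = g :=
  UnivCStar.hom_ext (isBounded_permRelators N ω) fun x => h x.1 x.2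

/-- The universal property of `C(U_N⁺(R))`. -/
def CUN.lift (a : Matrix (ZMod N) (ZMod N) B) (ha : IsAnyonicUnitary ω a) : CUN N ω →⋆ₐ[ℂ] B :=
  UnivCStar.lift (isBounded_unitaryRelators N ω) (fun g => a g.1 g.2)
    ((map_unitaryRelators _).mpr (by rwa [freeMatrix_map]))

@[simp]
theorem CUN.lift_uMat (a : Matrix (ZMod N) (ZMod N) B) (ha : IsAnyonicUnitary ω a)
    (i j : ZMod N) : CUN.lift a ha (uMat N ω i j) = a i j :=
  UnivCStar.lift_gen (isBounded_unitaryRelators N ω) (fun g => a g.1 g.2) _ (i, j)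

theorem CUN.hom_ext {f g : CUN N ω →⋆ₐ[ℂ] B} (h : ∀ i j, f (uMat N ω i j) = g (uMat N ω i j)) :
    f = g :=
  UnivCStar.hom_ext (isBounded_unitaryRelators N ω) fun x => h x.1 x.2

end lift

section structure_maps

variable (hω : IsPrimitiveRoot ω N)

/-- A family of `*`-homomorphisms defines a `*`-homomorphism to the functions. -/
def homPi {A B I : Type*} [CStarAlgebra A] [CStarAlgebra B] (f : I → (A →⋆ₐ[ℂ] B)) :
    A →⋆ₐ[ℂ] (I → B) where
  toFun a i := f i a
  map_one' := funext fun i => map_one (f i)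
  map_mul' a b := funext fun i => map_mul (f i) a b
  map_zero' := funext fun i => map_zero (f i)
  map_add' a b := funext fun i => map_add (f i) a b
  commutes' c := funext fun i => AlgHomClass.commutes (f i) c
  map_star' a := funext fun i => map_star (f i) a

/-- The automorphism `ρ_t` of `C(S_N⁺(R))`, with `ρ_t(qᵢⱼ) = ω ^ (t (j - i)) qᵢⱼ`. -/
def CSN.act (t : ZMod N) : CSN N ω →⋆ₐ[ℂ] CSN N ω :=
  CSN.lift (Matrix.of fun i j => chi ω (t * (j - i)) • qMat N ω i j)
    ((isAnyonicPerm_qMat N ω).smul hω t)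

/-- The automorphism `ρ_t` of `C(U_N⁺(R))`, with `ρ_t(uᵢⱼ) = ω ^ (t (j - i)) uᵢⱼ`. -/
def CUN.act (t : ZMod N) : CUN N ω →⋆ₐ[ℂ] CUN N ω :=
  CUN.lift (Matrix.of fun i j => chi ω (t * (j - i)) • uMat N ω i j)
    ((isAnyonicUnitary_uMat N ω).smul hω t)

theorem CSN.act_qMat (t i j : ZMod N) :
    CSN.act hω t (qMat N ω i j) = chi ω (t * (j - i)) • qMat N ω i j := by
  rw [CSN.act, CSN.lift_qMat, Matrix.of_apply]

theorem CUN.act_uMat (t i j : ZMod N) :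
    CUN.act hω t (uMat N ω i j) = chi ω (t * (j - i)) • uMat N ω i j := by
  rw [CUN.act, CUN.lift_uMat, Matrix.of_apply]

/-- The coaction on `C(S_N⁺(R))`, with `ρ_t(qᵢⱼ) = ω ^ (t (j - i)) qᵢⱼ`. -/
def ρS : Coaction N (CSN N ω) :=
  Coaction.ofAction (homPi (CSN.act hω))
    (fun x => by
      have h : CSN.act hω 0 = StarAlgHom.id ℂ (CSN N ω) := CSN.hom_ext fun i j => by
        rw [CSN.act_qMat, zero_mul, chi_zero, one_smul]; rfl
      exact congrArg (fun f => f x) h)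
    (fun x s t => by
      have h : (CSN.act hω s).comp (CSN.act hω t) = CSN.act hω (s + t) :=
        CSN.hom_ext fun i j => by
          rw [StarAlgHom.comp_apply, CSN.act_qMat, map_smul, CSN.act_qMat, CSN.act_qMat, smul_smul,
            ← chi_add hω, add_mul, add_comm]
      exact congrArg (fun f => f x) h)

/-- The coaction on `C(U_N⁺(R))`, with `ρ_t(uᵢⱼ) = ω ^ (t (j - i)) uᵢⱼ`. -/
def ρU : Coaction N (CUN N ω) :=
  Coaction.ofAction (homPi (CUN.act hω))
    (fun x => by
      have h : CUN.act hω 0 = StarAlgHom.id ℂ (CUN N ω) := CUN.hom_ext fun i j => by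
        rw [CUN.act_uMat, zero_mul, chi_zero, one_smul]; rfl
      exact congrArg (fun f => f x) h)
    (fun x s t => by
      have h : (CUN.act hω s).comp (CUN.act hω t) = CUN.act hω (s + t) :=
        CUN.hom_ext fun i j => by
          rw [StarAlgHom.comp_apply, CUN.act_uMat, map_smul, CUN.act_uMat, CUN.act_uMat, smul_smul,
            ← chi_add hω, add_mul, add_comm]
      exact congrArg (fun f => f x) h)

theorem isHomogeneous_qMat (i j : ZMod N) :
    IsHomogeneous ω (ρS hω) (j - i) (qMat N ω i j) := fun t => CSN.act_qMat hω t i j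

theorem isHomogeneous_uMat (i j : ZMod N) :
    IsHomogeneous ω (ρU hω) (j - i) (uMat N ω i j) := fun t => CUN.act_uMat hω t i j

theorem IsHomogeneous.star (hω : IsPrimitiveRoot ω N)
    {X : Type*} [CStarAlgebra X] {ρ : Coaction N X} {d : ZMod N} {x : X}
    (h : IsHomogeneous ω ρ d x) : IsHomogeneous ω ρ (-d) (star x) := fun t => by
  rw [map_star, Pi.star_apply, h, star_smul, chi_star hω, mul_neg]

/-- The braided tensor product `C(S_N⁺(R)) ⊠ C(S_N⁺(R))`. -/
abbrev CSN2 : Type _ := BraidedTensor hω (ρS hω) (ρS hω)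

/-- The braided tensor product `C(U_N⁺(R)) ⊠ C(U_N⁺(R))`. -/
abbrev CUN2 : Type _ := BraidedTensor hω (ρU hω) (ρU hω)

/-- The comultiplication of `S_N⁺(R)`, with `Δ(qᵢⱼ) = ∑ₖ j₁(qᵢₖ) j₂(qₖⱼ)`. -/
def ΔS : CSN N ω →⋆ₐ[ℂ] CSN2 hω :=
  CSN.lift ((qMat N ω).map (BraidedTensor.j₁ hω (ρS hω) (ρS hω)) *
      (qMat N ω).map (BraidedTensor.j₂ hω (ρS hω) (ρS hω)))
    (((isAnyonicPerm_qMat N ω).map _).mul hω ((isAnyonicPerm_qMat N ω).map _) fun i j k l =>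
      BraidedTensor.j₁_mul_j₂ hω (isHomogeneous_qMat hω i j) (isHomogeneous_qMat hω k l))

/-- The comultiplication of `U_N⁺(R)`, with `Δ(uᵢⱼ) = ∑ₖ j₁(uᵢₖ) j₂(uₖⱼ)`. -/
def ΔU : CUN N ω →⋆ₐ[ℂ] CUN2 hω :=
  CUN.lift ((uMat N ω).map (BraidedTensor.j₁ hω (ρU hω) (ρU hω)) *
      (uMat N ω).map (BraidedTensor.j₂ hω (ρU hω) (ρU hω)))
    (((isAnyonicUnitary_uMat N ω).map _).mul hω ((isAnyonicUnitary_uMat N ω).map _)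
      fun i j k l => by
        have h := BraidedTensor.j₁_mul_j₂ hω ((isHomogeneous_uMat hω i j).star hω)
          ((isHomogeneous_uMat hω k l).star hω)
        rwa [map_star, map_star, neg_sub, neg_sub] at h)

theorem ΔS_qMat (i j : ZMod N) :
    ΔS hω (qMat N ω i j) = ∑ k, BraidedTensor.j₁ hω (ρS hω) (ρS hω) (qMat N ω i k) *
      BraidedTensor.j₂ hω (ρS hω) (ρS hω) (qMat N ω k j) :=
  CSN.lift_qMat _ _ i j

theorem ΔU_uMat (i j : ZMod N) :
    ΔU hω (uMat N ω i j) = ∑ k, BraidedTensor.j₁ hω (ρU hω) (ρU hω) (uMat N ω i k) *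
      BraidedTensor.j₂ hω (ρU hω) (ρU hω) (uMat N ω k j) :=
  CUN.lift_uMat _ _ i j

/-- A `ℤ/N`-equivariant Hopf `*`-homomorphism `φ : C(U_N⁺(R)) → C(S_N⁺(R))`: an equivariant
morphism with `Δ φ = (φ ⊠ φ) Δ`. -/
def IsHopf (φ : EquivariantHom (ρU hω) (ρS hω)) : Prop :=
  ∀ a, ΔS hω (φ a) = BraidedTensor.map hω φ φ (ΔU hω a)

end structure_maps

end QuantumGroups

end Anyonic

end

open Anyonic

/-!
Relation (2) turns the entries of `q* q` and `q q*` into the right-hand sides of (3) and (4) with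
`k = 0`, up to a scalar, so (1) evaluates them to `δᵢⱼ`. By (2) again, the twisted conjugate of `q`
is `q` with both indices negated, hence unitary as well, and the universal property of
`C(U_N⁺(R))` yields `φ`. The range of `φ` contains the generators, so it is dense; it is closed
because elements of the range of a `*`-homomorphism of `C*`-algebras have preimages of controlled
norm.
-/

namespace Anyonic

section DenseRange

open scoped ComplexStarModule CStarAlgebra

variable {F A B : Type*} [NonUnitalCStarAlgebra A] [NonUnitalCStarAlgebra B] [FunLike F A B]
  [NonUnitalAlgHomClass F ℂ A B] [StarHomClass F A B]

theorem exists_map_eq_norm_le_of_isSelfAdjoint (φ : F) {a : A} (ha : IsSelfAdjoint a) :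
    ∃ a', φ a' = φ a ∧ ‖a'‖ ≤ ‖φ a‖ := by
  -- `φ a` is unchanged when the spectrum of `a` is truncated to `[-‖φ a‖, ‖φ a‖]`.
  set r : ℝ := ‖φ a‖
  have hr : 0 ≤ r := norm_nonneg _
  let clamp : ℝ → ℝ := fun x => max (-r) (min x r)
  have clamp_eq {x : ℝ} (hx : |x| ≤ r) : clamp x = x := by
    simp only [clamp, min_eq_left (abs_le.mp hx).2, max_eq_right (abs_le.mp hx).1]
  have clamp_zero : clamp 0 = 0 := clamp_eq (by rwa [abs_zero])
  have abs_clamp (x : ℝ) : |clamp x| ≤ r :=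
    abs_le.mpr ⟨le_max_left _ _, max_le (by linarith) (min_le_right _ _)⟩
  have hφa : IsSelfAdjoint (φ a) := ha.map φ
  refine ⟨cfcₙ clamp a, ?_, norm_cfcₙ_le fun x _ => abs_clamp x⟩
  calc φ (cfcₙ clamp a)
    _ = cfcₙ clamp (φ a) := NonUnitalStarAlgHomClass.map_cfcₙ φ clamp a
        (by fun_prop) clamp_zero (map_continuous φ) ha hφa
    _ = cfcₙ (fun x : ℝ => x) (φ a) := cfcₙ_congr fun x hx => clamp_eq <| by
        simpa only [cfcₙ_id' ℝ (φ a), Real.norm_eq_abs] using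
          norm_apply_le_norm_cfcₙ (fun x : ℝ => x) (φ a) hx
    _ = φ a := cfcₙ_id' ℝ (φ a)

theorem exists_map_eq_norm_le_two_mul (φ : F) (a : A) : ∃ a', φ a' = φ a ∧ ‖a'‖ ≤ 2 * ‖φ a‖ := by
  obtain ⟨x, hx, hx_le⟩ := exists_map_eq_norm_le_of_isSelfAdjoint φ (ℜ a).2
  obtain ⟨y, hy, hy_le⟩ := exists_map_eq_norm_le_of_isSelfAdjoint φ (ℑ a).2
  refine ⟨x + Complex.I • y, ?_, ?_⟩
  · rw [map_add, map_smul, hx, hy, ← map_smul, ← map_add, realPart_add_I_smul_imaginaryPart]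
  · rw [map_realPart] at hx_le
    rw [map_imaginaryPart] at hy_le
    calc ‖x + Complex.I • y‖
      _ ≤ ‖x‖ + ‖Complex.I • y‖ := norm_add_le _ _
      _ = ‖x‖ + ‖y‖ := by rw [norm_smul, Complex.norm_I, one_mul]
      _ ≤ ‖φ a‖ + ‖φ a‖ := add_le_add (hx_le.trans (realPart.norm_le (φ a)))
          (hy_le.trans (imaginaryPart.norm_le (φ a)))
      _ = 2 * ‖φ a‖ := (two_mul _).symm

theorem isClosed_range_of_starHomClass (φ : F) : IsClosed (Set.range φ) := by
  let f : NormedAddGroupHom A B :=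
    { toFun := φ
      map_add' := map_add φ
      bound' := ⟨1, fun a => by simpa only [one_mul] using NonUnitalStarAlgHom.norm_apply_le φ a⟩ }
  have hf : f.SurjectiveOnWith f.range 2 := by
    rintro _ ⟨a, rfl⟩
    exact exists_map_eq_norm_le_two_mul φ a
  refine isClosed_of_closure_subset fun b hb => ?_
  have hb' : b ∈ f.range.topologicalClosure := hb
  obtain ⟨a, ha, -⟩ := controlled_closure_of_complete two_pos one_pos hf b hb'
  exact ⟨a, ha⟩

theorem surjective_of_denseRange (φ : F) (hφ : DenseRange φ) : Function.Surjective φ :=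
  Set.range_eq_univ.mp <| by rw [← (isClosed_range_of_starHomClass φ).closure_eq, hφ.closure_range]

theorem UnivCStar.surjective_of_gen_mem_range {A G : Type*} [CStarAlgebra A]
    {R : Set (FreeStarAlg G)} (hR : IsBoundedPresentation R) (φ : A →⋆ₐ[ℂ] UnivCStar hR)
    (hφ : ∀ g, gen hR g ∈ Set.range φ) : Function.Surjective φ := by
  choose a ha using hφ
  have hφ_lift : φ.comp (FreeStarAlg.lift a) = mk hR :=
    FreeStarAlg.hom_ext fun g => by rw [StarAlgHom.comp_apply, FreeStarAlg.lift_gen, ha, gen]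
  refine surjective_of_denseRange φ ((dense_mk hR).mono ?_)
  rw [← hφ_lift, StarAlgHom.coe_comp]
  exact Set.range_comp_subset_range _ _

end DenseRange

section Unitarity

theorem submatrix_equiv_mem_unitary {m n R : Type*} [Fintype m] [DecidableEq m] [Fintype n]
    [DecidableEq n] [Semiring R] [StarRing R] {u : Matrix n n R} (hu : u ∈ unitary (Matrix n n R))
    (e : m ≃ n) : u.submatrix e e ∈ unitary (Matrix m m R) := by
  rw [Unitary.mem_iff] at hu ⊢
  simp only [Matrix.star_eq_conjTranspose, Matrix.conjTranspose_submatrix,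
    Matrix.submatrix_mul_equiv] at hu ⊢
  rw [hu.1, hu.2, Matrix.submatrix_one_equiv]
  exact ⟨rfl, rfl⟩

variable {N : ℕ} [NeZero N] {ω : ℂ} {B : Type*} [Ring B] [StarRing B] [Algebra ℂ B]
  {q : Matrix (ZMod N) (ZMod N) B}

theorem IsAnyonicPerm.star_mul_self (h : IsAnyonicPerm ω q) : star q * q = 1 := by
  ext i j
  calc (star q * q) i j
    _ = ∑ l, chi ω (-(l * (l - i))) • (q (-l) (-i) * q l j) := by
        simp only [Matrix.mul_apply, Matrix.star_apply, h.star_eq, smul_mul_assoc]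
    _ = ∑ l, chi ω (-(l * (-i - 0 + l))) • (q (0 - l) (-i) * q l j) :=
        Finset.sum_congr rfl fun l _ => by
          rw [zero_sub, show l * (-i - 0 + l) = l * (l - i) by ring]
    _ = q 0 (-i + j) := (h.right_add (-i) j 0).symm
    _ = (1 : Matrix (ZMod N) (ZMod N) B) i j := by
        simp only [h.zero_left, Matrix.one_apply, neg_add_eq_zero]

theorem IsAnyonicPerm.mul_star_self (hω : IsPrimitiveRoot ω N) (h : IsAnyonicPerm ω q) :
    q * star q = 1 := by
  ext i j
  calc (q * star q) i j
    _ = ∑ l, chi ω (-(j * (j - l))) • (q i l * q (-j) (-l)) := by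
        simp only [Matrix.mul_apply, Matrix.star_apply, h.star_eq, mul_smul_comm]
    _ = chi ω (j * (i - j)) • ∑ l, chi ω (-(-j * (l - i))) • (q i l * q (-j) (0 - l)) := by
        rw [Finset.smul_sum]
        refine Finset.sum_congr rfl fun l _ => ?_
        rw [smul_smul, ← chi_add hω, zero_sub,
          show j * (i - j) + -(-j * (l - i)) = -(j * (j - l)) by ring]
    _ = chi ω (j * (i - j)) • q (-j + i) 0 := by rw [← h.left_add]
    _ = (1 : Matrix (ZMod N) (ZMod N) B) i j := by
        rw [h.zero_right, Matrix.one_apply]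
        rcases eq_or_ne i j with rfl | hij
        · rw [neg_add_cancel, sub_self, mul_zero, chi_zero, one_smul, if_pos rfl, if_pos rfl]
        · rw [if_neg hij, if_neg (by rwa [neg_add_eq_zero, eq_comm]), smul_zero]

theorem IsAnyonicPerm.twistConj_eq_submatrix_neg (hω : IsPrimitiveRoot ω N)
    (h : IsAnyonicPerm ω q) :
    twistConj ω q = q.submatrix (Equiv.neg (ZMod N)) (Equiv.neg (ZMod N)) := by
  ext i j
  rw [twistConj_apply, h.star_eq, smul_smul, ← chi_add hω,
    show -(i * (j - i)) + -(i * (i - j)) = 0 by ring, chi_zero, one_smul, Matrix.submatrix_apply]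
  rfl

theorem IsAnyonicPerm.isAnyonicUnitary (hω : IsPrimitiveRoot ω N) (h : IsAnyonicPerm ω q) :
    IsAnyonicUnitary ω q := by
  have hq : q ∈ unitary (Matrix (ZMod N) (ZMod N) B) :=
    Unitary.mem_iff.mpr ⟨h.star_mul_self, h.mul_star_self hω⟩
  refine ⟨hq, ?_⟩
  rw [h.twistConj_eq_submatrix_neg hω]
  exact submatrix_equiv_mem_unitary hq _

end Unitarity

theorem EquivariantHom.toStarAlgHom_injective {N : ℕ} [NeZero N] {X Y : Type*} [CStarAlgebra X]
    [CStarAlgebra Y] {ρX : Coaction N X} {ρY : Coaction N Y} :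
    Function.Injective (toStarAlgHom : EquivariantHom ρX ρY → X →⋆ₐ[ℂ] Y) := by
  rintro ⟨φ, _⟩ ⟨_, _⟩ rfl
  rfl

section QuotientHom

variable {N : ℕ} [NeZero N] {ω : ℂ}

theorem surjective_of_apply_uMat (φ : CUN N ω →⋆ₐ[ℂ] CSN N ω)
    (hφ : ∀ i j, φ (uMat N ω i j) = qMat N ω i j) : Function.Surjective φ :=
  UnivCStar.surjective_of_gen_mem_range (isBounded_permRelators N ω) φ
    fun g => ⟨uMat N ω g.1 g.2, hφ g.1 g.2⟩

variable (hω : IsPrimitiveRoot ω N)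

theorem act_comp_eq_comp_act_of_apply_uMat {φ : CUN N ω →⋆ₐ[ℂ] CSN N ω}
    (hφ : ∀ i j, φ (uMat N ω i j) = qMat N ω i j) (t : ZMod N) :
    (CSN.act hω t).comp φ = φ.comp (CUN.act hω t) :=
  CUN.hom_ext fun i j => by
    rw [StarAlgHom.comp_apply, StarAlgHom.comp_apply, CUN.act_uMat, map_smul, hφ, CSN.act_qMat]

/-- The equivariant morphism `C(U_N⁺(R)) → C(S_N⁺(R))` with `uᵢⱼ ↦ qᵢⱼ`, which exists because
`q` satisfies the relations of `u`. -/
noncomputable def quotientHom : EquivariantHom (ρU hω) (ρS hω) where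
  toStarAlgHom := CUN.lift (qMat N ω) ((isAnyonicPerm_qMat N ω).isAnyonicUnitary hω)
  equivariant x t :=
    DFunLike.congr_fun (act_comp_eq_comp_act_of_apply_uMat hω
      (CUN.lift_uMat (qMat N ω) ((isAnyonicPerm_qMat N ω).isAnyonicUnitary hω)) t) x

theorem quotientHom_uMat (i j : ZMod N) : quotientHom hω (uMat N ω i j) = qMat N ω i j :=
  CUN.lift_uMat (qMat N ω) ((isAnyonicPerm_qMat N ω).isAnyonicUnitary hω) i j

variable {hω} {φ : EquivariantHom (ρU hω) (ρS hω)}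

theorem isHopf_of_apply_uMat (hφ : ∀ i j, φ (uMat N ω i j) = qMat N ω i j) : IsHopf hω φ := by
  have h : (ΔS hω).comp φ.toStarAlgHom = (BraidedTensor.map hω φ φ).comp (ΔU hω) :=
    CUN.hom_ext fun i j => by
      rw [StarAlgHom.comp_apply, StarAlgHom.comp_apply, hφ, ΔS_qMat, ΔU_uMat, map_sum]
      refine Finset.sum_congr rfl fun k _ => ?_
      rw [map_mul, BraidedTensor.map_j₁, BraidedTensor.map_j₂, hφ, hφ]
  exact DFunLike.congr_fun h

theorem eq_quotientHom_of_apply_uMat (hφ : ∀ i j, φ (uMat N ω i j) = qMat N ω i j) :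
    φ = quotientHom hω :=
  EquivariantHom.toStarAlgHom_injective <|
    CUN.hom_ext fun i j => (hφ i j).trans (quotientHom_uMat hω i j).symm

end QuotientHom

end Anyonic

theorem theorem2 (N : ℕ) [NeZero N] (ω : ℂ) (hω : IsPrimitiveRoot ω N) :
    -- the matrices `q` and `(ω ^ (-i (j - i)) qᵢⱼ*)` are unitary
    qMat N ω ∈ unitary (Matrix (ZMod N) (ZMod N) (CSN N ω)) ∧
    twistConj ω (qMat N ω) ∈ unitary (Matrix (ZMod N) (ZMod N) (CSN N ω)) ∧
    -- there is a unique equivariant Hopf `*`-homomorphism with `φ(uᵢⱼ) = qᵢⱼ`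
    (∃! φ : EquivariantHom (ρU hω) (ρS hω),
      IsHopf hω φ ∧ ∀ i j, φ (uMat N ω i j) = qMat N ω i j) ∧
    -- this homomorphism is surjective, so that it exhibits a quantum subgroup
    (∀ φ : EquivariantHom (ρU hω) (ρS hω),
      IsHopf hω φ → (∀ i j, φ (uMat N ω i j) = qMat N ω i j) → Function.Surjective φ) := by
  have hq : IsAnyonicUnitary ω (qMat N ω) := (isAnyonicPerm_qMat N ω).isAnyonicUnitary hω
  refine ⟨hq.unitary, hq.unitary_twist, ⟨quotientHom hω, ?_, ?_⟩, ?_⟩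
  · exact ⟨isHopf_of_apply_uMat (quotientHom_uMat hω), quotientHom_uMat hω⟩
  · exact fun ψ ⟨_, hψ⟩ => eq_quotientHom_of_apply_uMat hψ
  · exact fun φ _ hφ => surjective_of_apply_uMat φ.toStarAlgHom hφ
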